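/- Let $G$ be a countable discrete group, $\alpha: G\to\mathrm{Aut}(P)$ an action of $G$ by $*$-automorphisms on a nonzero unital $C^*$-algebra $P$, and $H\subsetneq K\le G$ subgroups with $[G:H]<\infty$. Let $C_c(G,P)$ be the $*$-algebra of finite sums $\sum a_g g$ ($a_g\in P$) with $(as)(bt)=a\,\alpha_s(b)\,st$ and $(as)^*=\alpha_{s^{-1}}(a^*)s^{-1}$. Let $A$ be either the reduced crossed product $P\rtimes_{\alpha,r}G$ (the completion of $C_c(G,P)$ in the norm given by the regular representation on $\mathcal H\otimes\ell^2(G)$, for any faithful representation $P\subset B(\mathcal H)$) or the universal crossed product $P\rtimes_\alpha G$ (the completion in the supremum of the norms $\|\pi(\cdot)\|$ over all $*$-homomorphisms $\pi:C_c(G,P)\to B(\mathcal K)$, $\mathcal K$ a Hilbert space). For a subgroup $L$ with $H\le L\le G$, the inclusion $C_c(L,P)\subset C_c(G,P)$ is isometric for the corresponding crossed product norms, so that the corresponding crossed product $P\rtimes L$ is a $C^*$-subalgebra of $A$, the closure of $C_c(L,P)$. Put $B=P\rtimes H$, $C=P\rtimes K$ and, for $g\in G$, $C_g=P\rtimes(g^{-1}Kg)$.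 Then the map $\sum_{g} a_g g\mapsto\sum_{h\in H}a_h h$ on $C_c(G,P)$ extends to a conditional expectation $E:A\to B$, and $E$ has finite index, i.e. there is a finite quasi-basis $\{\lambda_i\}\subset A$ with $x=\sum_i E(x\lambda_i)\lambda_i^*=\sum_i\lambda_iE(\lambda_i^*x)$ for all $x\in A$. Let $\mathrm{IMS}(B,A,E)$ be the set of $C^*$-subalgebras $B\subseteq D\subseteq A$ that admit a conditional expectation $F_D:A\to D$ with $E\circ F_D=E$. Such an $F_D$ is unique; regarded as an operator on the Hilbert $B$-module $A$ with $\langle x,y\rangle_B=E(x^*y)$, it is the Jones projection $e_D$ (in particular $e_B=E$). Let $A_1=\mathrm{span}\{xe_By: x,y\in A\}$ be the $C^*$-basic construction, $\mathrm{Ind}(E)=\sum_i\lambda_i\lambda_i^*$, and $E_1:A_1\to A$ the dual conditional expectation, $E_1(xe_By)=\mathrm{Ind}(E)^{-1}xy$. For $D,D'\in\mathrm{IMS}(B,A,E)\setminus\{B\}$ the interior angle $\alpha(D,D')\in[0,\frac{\pi}{2}]$ with respect to $E$ is defined by $$\cos\alpha(D,D')=\frac{\|E_1\big((e_D-e_B)^*(e_{D'}-e_B)\big)\|}{\|E_1\big((e_D-e_B)^*(e_D-e_B)\big)\|^{1/2}\,\|E_1\big((e_{D'}-e_B)^*(e_{D'}-e_B)\big)\|^{1/2}}.$$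 If $g\in\mathcal N_G(H)=\{g\in G: g^{-1}Hg=H\}$, then $C,C_g\in\mathrm{IMS}(B,A,E)\setminus\{B\}$, and $\alpha(C,C_g)=0$ if and only if $g\in\mathcal N_G(K)$. -/

import Mathlib

universe u v w

noncomputable section

open scoped ENNReal

/-! ### C*-seminorms and completions -/

/-- A C*-seminorm on a complex unital `*`-algebra. -/
structure CStarSeminorm (R : Type*) [Ring R] [StarRing R] [Algebra ℂ R] extends
    Seminorm ℂ R where
  mul_le' : ∀ x y : R, toFun (x * y) ≤ toFun x * toFun y
  star_mul_self' : ∀ x : R, toFun (star x * x) = toFun x * toFun x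

namespace CStarSeminorm

variable {R : Type*} [Ring R] [StarRing R] [Algebra ℂ R]

instance : CoeFun (CStarSeminorm R) (fun _ => R → ℝ) := ⟨fun N => N.toFun⟩

theorem nonneg (N : CStarSeminorm R) (x : R) : 0 ≤ N x := apply_nonneg N.toSeminorm x

theorem le_star (N : CStarSeminorm R) (x : R) : N x ≤ N (star x) := by
  have h1 : N x * N x ≤ N (star x) * N x := by
    rw [← N.star_mul_self']; exact N.mul_le' _ _
  rcases (N.nonneg x).eq_or_lt with h | h
  · rw [← h]; exact N.nonneg _
  · exact le_of_mul_le_mul_right h1 h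

theorem star_eq (N : CStarSeminorm R) (x : R) : N (star x) = N x :=
  le_antisymm (by simpa using N.le_star (star x)) (N.le_star x)

/-- The C*-seminorm `x ↦ ‖ρ x‖` of a `*`-homomorphism `ρ` into a C*-algebra. -/
def ofHom {𝓑 : Type*} [CStarAlgebra 𝓑] (ρ : R →⋆ₐ[ℂ] 𝓑) : CStarSeminorm R where
  toFun x := ‖ρ x‖
  map_zero' := by simp
  add_le' x y := by simpa using norm_add_le (ρ x) (ρ y)
  neg' x := by simp
  smul' c x := by simp [norm_smul]
  mul_le' x y := by simpa using norm_mul_le (ρ x) (ρ y)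
  star_mul_self' x := by
    rw [map_mul, map_star, CStarRing.norm_star_mul_self]

/-- The `*`-algebra `R`, equipped with the seminorm `N`. -/
def Pre (_N : CStarSeminorm R) : Type _ := R

variable (N : CStarSeminorm R)

instance : Ring N.Pre := inferInstanceAs (Ring R)
instance : StarRing N.Pre := inferInstanceAs (StarRing R)
instance : Algebra ℂ N.Pre := inferInstanceAs (Algebra ℂ R)

instance : SeminormedRing N.Pre :=
  { (inferInstance : Ring N.Pre),
    AddGroupSeminorm.toSeminormedAddCommGroup (E := N.Pre)
      N.toSeminorm.toAddGroupSeminorm with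
    norm_mul_le := N.mul_le' }

theorem norm_pre (x : N.Pre) : ‖x‖ = N x := rfl

instance : NormedAlgebra ℂ N.Pre where
  norm_smul_le c x := le_of_eq (N.smul' c x)

instance [StarModule ℂ R] : StarModule ℂ N.Pre := inferInstanceAs (StarModule ℂ R)

instance : NormedStarGroup N.Pre where
  norm_star_le x := (N.star_eq x).le

/-- The completion of the `*`-algebra `R` with respect to the C*-seminorm `N`
(null vectors of `N` are divided out). -/
abbrev Compl : Type _ := UniformSpace.Completion N.Pre

open UniformSpace

theorem uniformContinuous_star : UniformContinuous (star : N.Pre → N.Pre) :=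
  (AddMonoidHomClass.isometry_of_norm (starAddEquiv : N.Pre ≃+ N.Pre)
    (fun x => norm_star x)).uniformContinuous

instance : Star N.Compl := ⟨Completion.map star⟩

theorem coe_star (x : N.Pre) : ((star x : N.Pre) : N.Compl) = star (x : N.Compl) :=
  (Completion.map_coe N.uniformContinuous_star x).symm

theorem continuous_star : Continuous (star : N.Compl → N.Compl) := Completion.continuous_map

instance : StarRing N.Compl where
  star_involutive x := by
    refine Completion.induction_on x
      (isClosed_eq (N.continuous_star.comp N.continuous_star) continuous_id) fun a => ?_
    rw [← coe_star, ← coe_star, star_star]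
  star_mul x y := by
    refine Completion.induction_on₂ x y (isClosed_eq (N.continuous_star.comp continuous_mul)
      ((N.continuous_star.comp continuous_snd).mul (N.continuous_star.comp continuous_fst)))
      fun a b => ?_
    rw [← Completion.coe_mul, ← coe_star, star_mul, Completion.coe_mul, coe_star, coe_star]
  star_add x y := by
    refine Completion.induction_on₂ x y (isClosed_eq (N.continuous_star.comp continuous_add)
      ((N.continuous_star.comp continuous_fst).add (N.continuous_star.comp continuous_snd)))
      fun a b => ?_
    rw [← Completion.coe_add, ← coe_star, star_add, Completion.coe_add, coe_star, coe_star]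

instance [StarModule ℂ R] : CStarAlgebra N.Compl where
  norm_smul_le c x := norm_smul_le c x
  norm_mul_self_le x := by
    refine Completion.induction_on x (isClosed_le (continuous_norm.mul continuous_norm)
      (continuous_norm.comp (N.continuous_star.mul continuous_id))) fun a => ?_
    rw [← coe_star, ← Completion.coe_mul, Completion.norm_coe, Completion.norm_coe]
    exact (N.star_mul_self' a).ge
  star_smul c x := by
    refine Completion.induction_on x (isClosed_eq
      (N.continuous_star.comp (continuous_const_smul c))
      ((continuous_const_smul _).comp N.continuous_star)) fun a => ?_
    rw [← Completion.coe_smul, ← coe_star, star_smul, Completion.coe_smul, coe_star]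

/-- The canonical `*`-homomorphism from `R` to its completion. -/
def ι [StarModule ℂ R] : R →⋆ₐ[ℂ] N.Compl where
  toFun x := ((show N.Pre from x : N.Pre) : N.Compl)
  map_one' := Completion.coe_one N.Pre
  map_mul' x y := Completion.coe_mul (α := N.Pre) x y
  map_zero' := Completion.coe_zero
  map_add' x y := Completion.coe_add (α := N.Pre) x y
  commutes' _ := rfl
  map_star' x := N.coe_star x

theorem norm_ι [StarModule ℂ R] (x : R) : ‖N.ι x‖ = N x := Completion.norm_coe (E := N.Pre) x

theorem denseRange_ι [StarModule ℂ R] : DenseRange N.ι :=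
  Completion.denseRange_coe (α := N.Pre)

end CStarSeminorm

/-! ### The algebraic crossed product `C_c(G, P)` -/

section Algebraic

variable {P : Type u} [CStarAlgebra P] {G : Type v} [Group G]

/-- Finitely supported functions `G → P`, i.e. finite formal sums `∑ a_g g`, for an action `α`
of the (discrete) group `G` on `P` by `*`-automorphisms. -/
def Cc (_α : G →* (P ≃⋆ₐ[ℂ] P)) : Type (max u v) := G →₀ P

namespace Cc

variable (α : G →* (P ≃⋆ₐ[ℂ] P))

instance : AddCommGroup (Cc α) := inferInstanceAs (AddCommGroup (G →₀ P))
instance : Module ℂ (Cc α) := inferInstanceAs (Module ℂ (G →₀ P))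

/-- The element `a g` of `C_c(G, P)`. -/
def single (g : G) (a : P) : Cc α := Finsupp.single g a

/-- The coefficient of `x ∈ C_c(G, P)` at `g`. -/
def coeff (x : Cc α) (g : G) : P := (show G →₀ P from x) g

/-- The `P`-coefficient map as an additive map `a ↦ a g`. -/
def singleHom (g : G) : P →+ Cc α := Finsupp.singleAddHom g

variable {α}

theorem addHom_ext {M : Type*} [AddMonoid M] {f h : Cc α →+ M}
    (H : ∀ g a, f (single α g a) = h (single α g a)) : f = h :=
  Finsupp.addHom_ext H

theorem induction_on {p : Cc α → Prop} (x : Cc α) (h0 : p 0)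
    (hadd : ∀ x y, p x → p y → p (x + y)) (hs : ∀ g a, p (single α g a)) : p x :=
  Finsupp.induction_linear (motive := p) x h0 hadd hs

/-- The additive map on `C_c(G, P)` with prescribed values on the elements `a g`. -/
def lift {M : Type*} [AddCommMonoid M] (f : G → P →+ M) : Cc α →+ M := Finsupp.liftAddHom f

@[simp] theorem lift_single {M : Type*} [AddCommMonoid M] (f : G → P →+ M) (g : G) (a : P) :
    lift f (single α g a) = f g a := Finsupp.liftAddHom_apply_single f g a

theorem single_add (g : G) (a b : P) : single α g (a + b) = single α g a + single α g b :=
  Finsupp.single_add g a b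

theorem smul_single (c : ℂ) (g : G) (a : P) : c • single α g a = single α g (c • a) :=
  Finsupp.smul_single c g a

variable (α)

/-- Multiplication, as a biadditive map determined by `(a s)(b t) = a α_s(b) st`. -/
def mulHom : Cc α →+ Cc α →+ Cc α :=
  lift fun s =>
    { toFun := fun a => lift fun t =>
        (singleHom α (s * t)).comp ((AddMonoidHom.mulLeft a).comp
          ((α s : P →⋆ₐ[ℂ] P) : P →+ P))
      map_zero' := by
        refine addHom_ext fun t b => ?_
        simp
      map_add' := fun a a' => by
        refine addHom_ext fun t b => ?_
        simp [add_mul] }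

instance : Mul (Cc α) := ⟨fun x y => mulHom α x y⟩

instance : One (Cc α) := ⟨single α 1 1⟩

theorem one_def : (1 : Cc α) = single α 1 1 := rfl

theorem mul_def (x y : Cc α) : x * y = mulHom α x y := rfl

theorem single_mul_single (s t : G) (a b : P) :
    single α s a * single α t b = single α (s * t) (a * α s b) := by
  rw [mul_def, mulHom, lift_single]
  exact lift_single _ t b

theorem mul_add' (x y z : Cc α) : x * (y + z) = x * y + x * z := map_add (mulHom α x) y z

theorem add_mul' (x y z : Cc α) : (x + y) * z = x * z + y * z := by
  rw [mul_def, map_add]; rfl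

theorem zero_mul' (x : Cc α) : 0 * x = 0 := by
  rw [mul_def, map_zero]; rfl

theorem mul_zero' (x : Cc α) : x * 0 = 0 := map_zero (mulHom α x)

instance : Ring (Cc α) :=
  { (inferInstance : AddCommGroup (Cc α)) with
  left_distrib := mul_add' α
  right_distrib := add_mul' α
  zero_mul := zero_mul' α
  mul_zero := mul_zero' α
  mul_assoc := fun x y z => by
    induction x using induction_on with
    | h0 => simp only [zero_mul']
    | hadd x x' h h' => simp only [add_mul', h, h']
    | hs r a =>
      induction y using induction_on with
      | h0 => simp only [zero_mul', mul_zero']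
      | hadd y y' h h' => simp only [add_mul', mul_add', h, h']
      | hs s b =>
        induction z using induction_on with
        | h0 => simp only [mul_zero']
        | hadd y y' h h' => simp only [mul_add', h, h']
        | hs t c => simp [single_mul_single, mul_assoc, map_mul]
  one_mul := fun x => by
    induction x using induction_on with
    | h0 => exact mul_zero' α _
    | hadd x x' h h' => rw [mul_add', h, h']
    | hs r a => simp [one_def, single_mul_single]
  mul_one := fun x => by
    induction x using induction_on with
    | h0 => exact zero_mul' α _
    | hadd x x' h h' => rw [add_mul', h, h']
    | hs r a => simp [one_def, single_mul_single] }

instance : Algebra ℂ (Cc α) :=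
  Algebra.ofModule
    (fun c x y => by
      induction x using induction_on with
      | h0 => simp
      | hadd x x' h h' => simp only [smul_add, add_mul, h, h']
      | hs r a =>
        induction y using induction_on with
        | h0 => simp
        | hadd y y' h h' => simp only [smul_add, mul_add, h, h']
        | hs s b => simp [smul_single, single_mul_single])
    (fun c x y => by
      induction x using induction_on with
      | h0 => simp
      | hadd x x' h h' => simp only [smul_add, add_mul, h, h']
      | hs r a =>
        induction y using induction_on with
        | h0 => simp
        | hadd y y' h h' => simp only [smul_add, mul_add, h, h']
        | hs s b => simp [smul_single, single_mul_single])

/-- The involution, determined by `(a s)^* = α_{s⁻¹}(a^*) s⁻¹`. -/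
def starHom : Cc α →+ Cc α :=
  lift fun s => (singleHom α s⁻¹).comp
    (((α s⁻¹ : P →⋆ₐ[ℂ] P) : P →+ P).comp (starAddEquiv : P ≃+ P).toAddMonoidHom)

instance : Star (Cc α) := ⟨starHom α⟩

theorem star_single (s : G) (a : P) :
    star (single α s a) = single α s⁻¹ (α s⁻¹ (star a)) :=
  lift_single _ s a

theorem star_add' (x y : Cc α) : star (x + y) = star x + star y := map_add (starHom α) x y

theorem star_zero' : star (0 : Cc α) = 0 := map_zero (starHom α)

theorem apply_inv_apply (s : G) (a : P) : α s⁻¹ (α s a) = a := by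
  rw [← StarAlgEquiv.mul_apply, ← map_mul, inv_mul_cancel, map_one]; rfl

theorem apply_apply_inv (s : G) (a : P) : α s (α s⁻¹ a) = a := by
  rw [← StarAlgEquiv.mul_apply, ← map_mul, mul_inv_cancel, map_one]; rfl

instance : StarRing (Cc α) where
  star_add := star_add' α
  star_involutive x := by
    induction x using induction_on with
    | h0 => simp only [star_zero']
    | hadd x x' h h' => rw [star_add', star_add', h, h']
    | hs s a =>
      rw [star_single, star_single, ← map_star, star_star, inv_inv, apply_apply_inv]
  star_mul x y := by
    induction x using induction_on with
    | h0 => simp only [star_zero', zero_mul, mul_zero]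
    | hadd x x' h h' => simp only [star_add', add_mul, mul_add, h, h']
    | hs s a =>
      induction y using induction_on with
      | h0 => simp only [star_zero', zero_mul, mul_zero]
      | hadd x x' h h' => simp only [star_add', add_mul, mul_add, h, h']
      | hs t b =>
        simp only [star_single, single_mul_single, mul_inv_rev, star_mul, map_mul,
          ← map_star, apply_inv_apply, StarAlgEquiv.mul_apply]

instance : StarModule ℂ (Cc α) where
  star_smul c x := by
    induction x using induction_on with
    | h0 => simp
    | hadd x x' h h' => simp only [star_add, smul_add, h, h']
    | hs s a => simp [smul_single, star_single]

/-- The restriction of the action to a subgroup. -/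
abbrev res (K : Subgroup G) : K →* (P ≃⋆ₐ[ℂ] P) := α.comp K.subtype

/-- The canonical inclusion `C_c(K, P) → C_c(G, P)`, `∑ a_k k ↦ ∑ a_k k`. -/
def inclHom (K : Subgroup G) : Cc (res α K) →+ Cc α := lift fun k => singleHom α (k : G)

theorem inclHom_single (K : Subgroup G) (k : K) (a : P) :
    inclHom α K (single (res α K) k a) = single α (k : G) a := lift_single _ k a

/-- The canonical inclusion `C_c(K, P) → C_c(G, P)` as a `*`-homomorphism. -/
def incl (K : Subgroup G) : Cc (res α K) →⋆ₐ[ℂ] Cc α where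
  toFun := inclHom α K
  map_one' := by rw [one_def, inclHom_single]; rfl
  map_zero' := map_zero _
  map_add' := map_add _
  map_mul' x y := by
    induction x using induction_on with
    | h0 => simp
    | hadd x x' h h' => simp only [map_add, add_mul, h, h']
    | hs r a =>
      induction y using induction_on with
      | h0 => simp
      | hadd y y' h h' => simp only [map_add, mul_add, h, h']
      | hs s b => simp [single_mul_single, inclHom_single]
  commutes' c := by
    rw [Algebra.algebraMap_eq_smul_one, Algebra.algebraMap_eq_smul_one, one_def, one_def,
      smul_single, smul_single, inclHom_single]; rfl
  map_star' x := by
    induction x using induction_on with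
    | h0 => simp
    | hadd x x' h h' => simp only [map_add, star_add, h, h']
    | hs r a => simp [star_single, inclHom_single]

open Classical in
/-- The map `∑ a_g g ↦ ∑_{h ∈ H} a_h h`, with values in the copy of `C_c(H, P)` inside
`C_c(G, P)`. -/
def restrict (H : Subgroup G) (x : Cc α) : Cc α :=
  Finsupp.filter (fun g => g ∈ H) (show G →₀ P from x)

end Cc

end Algebraic

/-! ### The reduced and the universal crossed product -/

section Norms

variable {P : Type u} [CStarAlgebra P] {G : Type v} [Group G]

namespace Cc

section Reduced

variable (α : G →* (P ≃⋆ₐ[ℂ] P))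

theorem memℓp_shift {H : Type w} [NormedAddCommGroup H] (s : G) (ξ : lp (fun _ : G => H) 2) :
    Memℓp (fun t : G => ξ (s⁻¹ * t)) 2 := by
  have h := lp.memℓp ξ
  rw [memℓp_gen_iff (by norm_num)] at h ⊢
  exact (Equiv.mulLeft s⁻¹).summable_iff.2 h

variable {H : Type w} [NormedAddCommGroup H] [InnerProductSpace ℂ H] [CompleteSpace H]

theorem norm_rep_le (φ : P →⋆ₐ[ℂ] (H →L[ℂ] H)) (s : G) (a : P) (ξ : H) :
    ‖φ (α s a) ξ‖ ≤ ‖a‖ * ‖ξ‖ := by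
  refine ((φ (α s a)).le_opNorm ξ).trans ?_
  gcongr
  exact (NonUnitalStarAlgHom.norm_apply_le φ _).trans
    (NonUnitalStarAlgHom.norm_apply_le (α s : P →⋆ₐ[ℂ] P) a)

/-- The isometric shift `1 ⊗ λ_s` on `ℓ²(G, H) = H ⊗ ℓ²(G)`. -/
def shift (s : G) (ξ : lp (fun _ : G => H) 2) : lp (fun _ : G => H) 2 :=
  ⟨fun t => ξ (s⁻¹ * t), memℓp_shift s ξ⟩

theorem norm_shift (s : G) (ξ : lp (fun _ : G => H) 2) : ‖shift s ξ‖ = ‖ξ‖ := by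
  rw [lp.norm_eq_tsum_rpow (by norm_num), lp.norm_eq_tsum_rpow (by norm_num)]
  congr 1
  exact (Equiv.mulLeft s⁻¹).tsum_eq (fun t => ‖ξ t‖ ^ (2 : ℝ≥0∞).toReal)

theorem memℓp_op (φ : P →⋆ₐ[ℂ] (H →L[ℂ] H)) (s : G) (a : P) (ξ : lp (fun _ : G => H) 2) :
    Memℓp (fun t : G => φ (α t⁻¹ a) (ξ (s⁻¹ * t))) 2 := by
  have h := (lp.memℓp ((‖a‖ : ℂ) • shift s ξ))
  refine Memℓp.mono' (F := fun _ : G => H) (E := fun _ : G => H) h fun t => ?_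
  refine (norm_rep_le α φ _ _ _).trans (le_of_eq ?_)
  rw [lp.coeFn_smul, Pi.smul_apply, norm_smul]
  simp [shift]

/-- The operator `π(a) (1 ⊗ λ_s)` on `ℓ²(G, H)`, where
`π(a)(ξ ⊗ δ_g) = φ(α_{g⁻¹}(a)) ξ ⊗ δ_g` and `λ_s δ_g = δ_{sg}`. -/
def op (φ : P →⋆ₐ[ℂ] (H →L[ℂ] H)) (s : G) (a : P) :
    lp (fun _ : G => H) 2 →L[ℂ] lp (fun _ : G => H) 2 :=
  LinearMap.mkContinuous
    { toFun := fun ξ => ⟨fun t => φ (α t⁻¹ a) (ξ (s⁻¹ * t)), memℓp_op α φ s a ξ⟩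
      map_add' := fun ξ η => by
        ext t
        exact map_add (φ (α t⁻¹ a)) _ _
      map_smul' := fun c ξ => by
        ext t
        exact map_smul (φ (α t⁻¹ a)) c _ }
    ‖a‖ (fun ξ => by
      have h : ‖(‖a‖ : ℂ) • shift s ξ‖ = ‖a‖ * ‖ξ‖ := by
        rw [norm_smul, norm_shift]; simp
      rw [← h]
      refine lp.norm_mono (by norm_num) fun t => ?_
      refine (norm_rep_le α φ _ _ _).trans (le_of_eq ?_)
      rw [lp.coeFn_smul, Pi.smul_apply, norm_smul]
      simp [shift])

theorem op_apply (φ : P →⋆ₐ[ℂ] (H →L[ℂ] H)) (s : G) (a : P) (ξ : lp (fun _ : G => H) 2)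
    (t : G) : op α φ s a ξ t = φ (α t⁻¹ a) (ξ (s⁻¹ * t)) := rfl

theorem op_mul (φ : P →⋆ₐ[ℂ] (H →L[ℂ] H)) (s t : G) (a b : P) :
    op α φ s a * op α φ t b = op α φ (s * t) (a * α s b) := by
  ext ξ u
  rw [mul_apply_eq_comp, op_apply, op_apply, op_apply, map_mul, map_mul,
    mul_apply_eq_comp, ← StarAlgEquiv.mul_apply, ← map_mul, mul_inv_rev, inv_inv,
    mul_inv_rev, mul_assoc]

theorem op_star (φ : P →⋆ₐ[ℂ] (H →L[ℂ] H)) (s : G) (a : P) :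
    star (op α φ s a) = op α φ s⁻¹ (α s⁻¹ (star a)) := by
  rw [ContinuousLinearMap.star_eq_adjoint]
  symm
  rw [ContinuousLinearMap.eq_adjoint_iff]
  intro ξ η
  rw [lp.inner_eq_tsum, lp.inner_eq_tsum, ← (Equiv.mulLeft s).tsum_eq
    (fun t => inner ℂ (ξ t) (op α φ s a η t))]
  refine tsum_congr fun t => ?_
  rw [op_apply, Equiv.coe_mulLeft, op_apply, ← StarAlgEquiv.mul_apply, ← map_mul,
    inv_inv, map_star, map_star, ContinuousLinearMap.star_eq_adjoint,
    ContinuousLinearMap.adjoint_inner_left, mul_inv_rev, inv_mul_cancel_left]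

/-- The regular representation `∑ a_g g ↦ ∑ π(a_g)(1 ⊗ λ_g)`, as an additive map. -/
def regularHom (φ : P →⋆ₐ[ℂ] (H →L[ℂ] H)) :
    Cc α →+ (lp (fun _ : G => H) 2 →L[ℂ] lp (fun _ : G => H) 2) :=
  lift fun s =>
    { toFun := fun a => op α φ s a
      map_zero' := by ext ξ t; simp [op_apply]
      map_add' := fun a b => by ext ξ t; simp [op_apply] }

theorem regularHom_single (φ : P →⋆ₐ[ℂ] (H →L[ℂ] H)) (s : G) (a : P) :
    regularHom α φ (single α s a) = op α φ s a := lift_single _ s a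

/-- The regular representation of `C_c(G, P)` on `ℓ²(G, H)` associated with a representation
`φ` of `P` on `H`. -/
def regular (φ : P →⋆ₐ[ℂ] (H →L[ℂ] H)) :
    Cc α →⋆ₐ[ℂ] (lp (fun _ : G => H) 2 →L[ℂ] lp (fun _ : G => H) 2) where
  toFun := regularHom α φ
  map_one' := by
    rw [one_def, regularHom_single]
    ext ξ t
    simp [op_apply]
  map_zero' := map_zero _
  map_add' := map_add _
  map_mul' x y := by
    induction x using induction_on with
    | h0 => simp
    | hadd x x' h h' => simp only [map_add, add_mul, h, h']
    | hs r a =>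
      induction y using induction_on with
      | h0 => simp
      | hadd y y' h h' => simp only [map_add, mul_add, h, h']
      | hs s b => simp only [single_mul_single, regularHom_single, op_mul]
  commutes' c := by
    rw [Algebra.algebraMap_eq_smul_one, Algebra.algebraMap_eq_smul_one, one_def,
      smul_single, regularHom_single]
    ext ξ t
    simp [op_apply]
  map_star' x := by
    induction x using induction_on with
    | h0 => simp
    | hadd x x' h h' => simp only [map_add, star_add, h, h']
    | hs r a => simp only [star_single, regularHom_single, op_star]

/-- The reduced norm on `C_c(G, P)`, computed from a (faithful) representation `φ` of `P`. -/
def reducedNorm (φ : P →⋆ₐ[ℂ] (H →L[ℂ] H)) : CStarSeminorm (Cc α) :=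
  CStarSeminorm.ofHom (regular α φ)

end Reduced

section Universal

variable (α : G →* (P ≃⋆ₐ[ℂ] P))

/-- The set of all values `‖π(x)‖`, where `π` is a `*`-homomorphism from `C_c(G, P)` into the
bounded operators on a Hilbert space. Every cyclic representation lives, up to unitary
equivalence, on a Hilbert space in the universe used here. -/
def repNorms (x : Cc α) : Set ℝ :=
  {r | ∃ (H : Type (max u v)) (_ : NormedAddCommGroup H) (_ : InnerProductSpace ℂ H)
    (_ : CompleteSpace H) (π : Cc α →⋆ₙₐ[ℂ] (H →L[ℂ] H)), r = ‖π x‖}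

theorem repNorms_nonempty (x : Cc α) : (repNorms α x).Nonempty :=
  ⟨_, PUnit, inferInstance, inferInstance, inferInstance, 0, rfl⟩

/-- The inclusion `P → C_c(G, P)`, `a ↦ a 1`, as a `*`-homomorphism. -/
def coeffHom : P →⋆ₙₐ[ℂ] Cc α where
  toFun a := single α 1 a
  map_smul' c a := (smul_single c 1 a).symm
  map_zero' := map_zero (singleHom α 1)
  map_add' := single_add 1
  map_mul' a b := by rw [single_mul_single]; simp
  map_star' a := by rw [star_single]; simp

theorem bddAbove_repNorms (x : Cc α) : ∃ C : ℝ, ∀ r ∈ repNorms α x, r ≤ C := by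
  induction x using induction_on with
  | h0 =>
    refine ⟨0, ?_⟩
    rintro r ⟨H, _, _, _, π, rfl⟩
    simp
  | hadd x y hx hy =>
    obtain ⟨C, hC⟩ := hx
    obtain ⟨D, hD⟩ := hy
    refine ⟨C + D, ?_⟩
    rintro r ⟨H, _, _, _, π, rfl⟩
    rw [map_add]
    exact (norm_add_le _ _).trans
      (add_le_add (hC _ ⟨H, _, _, _, π, rfl⟩) (hD _ ⟨H, _, _, _, π, rfl⟩))
  | hs s a =>
    refine ⟨‖a‖, ?_⟩
    rintro r ⟨H, _, _, _, π, rfl⟩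
    have h1 : single α s a * star (single α s a) = coeffHom α (a * star a) := by
      rw [star_single, single_mul_single, apply_apply_inv, mul_inv_cancel]; rfl
    have h2 : ‖π (single α s a)‖ * ‖π (single α s a)‖ ≤ ‖a‖ * ‖a‖ := by
      rw [← CStarRing.norm_self_mul_star, ← map_star, ← map_mul, h1,
        ← CStarRing.norm_self_mul_star]
      exact NonUnitalStarAlgHom.norm_apply_le (π.comp (coeffHom α)) (a * star a)
    exact abs_le_of_sq_le_sq' (by nlinarith) (norm_nonneg _) |>.2

theorem le_universal {H : Type (max u v)} [NormedAddCommGroup H] [InnerProductSpace ℂ H]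
    [CompleteSpace H] (π : Cc α →⋆ₙₐ[ℂ] (H →L[ℂ] H)) (x : Cc α) :
    ‖π x‖ ≤ sSup (repNorms α x) :=
  le_csSup (bddAbove_repNorms α x) ⟨H, _, _, _, π, rfl⟩

theorem universal_le {x : Cc α} {C : ℝ}
    (h : ∀ (H : Type (max u v)) (_ : NormedAddCommGroup H) (_ : InnerProductSpace ℂ H)
      (_ : CompleteSpace H) (π : Cc α →⋆ₙₐ[ℂ] (H →L[ℂ] H)), ‖π x‖ ≤ C) :
    sSup (repNorms α x) ≤ C :=
  csSup_le (repNorms_nonempty α x) fun _ ⟨H, i1, i2, i3, π, hr⟩ => hr ▸ h H i1 i2 i3 π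

theorem universal_nonneg (x : Cc α) : 0 ≤ sSup (repNorms α x) :=
  Real.sSup_nonneg fun _ ⟨_, _, _, _, _, hr⟩ => hr ▸ norm_nonneg _

theorem universal_smul_le (c : ℂ) (x : Cc α) :
    sSup (repNorms α (c • x)) ≤ ‖c‖ * sSup (repNorms α x) := by
  refine universal_le α fun H _ _ _ π => ?_
  rw [map_smul, norm_smul]
  exact mul_le_mul_of_nonneg_left (le_universal α π x) (norm_nonneg c)

/-- The universal norm on `C_c(G, P)`: the supremum of `‖π(x)‖` over all `*`-homomorphisms
`π : C_c(G, P) → B(H)`. -/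
def universalNorm : CStarSeminorm (Cc α) where
  toSeminorm := Seminorm.ofSMulLE (fun x => sSup (repNorms α x))
    (le_antisymm (universal_le α fun H _ _ _ π => by simp) (universal_nonneg α 0))
    (fun x y => universal_le α fun H _ _ _ π => by
      rw [map_add]
      exact (norm_add_le _ _).trans (add_le_add (le_universal α π x) (le_universal α π y)))
    (universal_smul_le α)
  mul_le' x y := universal_le α fun H _ _ _ π => by
    rw [map_mul]
    exact (norm_mul_le _ _).trans (mul_le_mul (le_universal α π x) (le_universal α π y)
      (norm_nonneg _) (universal_nonneg α x))
  star_mul_self' x := by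
    refine le_antisymm (universal_le α fun H _ _ _ π => ?_) ?_
    · rw [map_mul, map_star, CStarRing.norm_star_mul_self]
      exact mul_le_mul (le_universal α π x) (le_universal α π x)
        (norm_nonneg _) (universal_nonneg α x)
    · have h : sSup (repNorms α x) ≤ √(sSup (repNorms α (star x * x))) := by
        refine universal_le α fun H _ _ _ π => Real.le_sqrt_of_sq_le ?_
        have := le_universal α π (star x * x)
        rwa [map_mul, map_star, CStarRing.norm_star_mul_self, ← sq] at this
      have h2 := mul_self_le_mul_self (universal_nonneg α x) h
      rwa [Real.mul_self_sqrt (universal_nonneg α _)] at h2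

theorem universalNorm_apply (x : Cc α) : universalNorm α x = sSup (repNorms α x) := rfl

end Universal

end Cc

end Norms

/-! ### Conditional expectations, Watatani index and interior angles -/

section Angles

variable {A : Type*} [CStarAlgebra A]

/-- `E` is a conditional expectation of the C*-algebra `A` onto its subalgebra `B`: a positive
`B`-bimodule projection of `A` onto `B`. -/
structure IsConditionalExpectation (B : StarSubalgebra ℂ A) (E : A →ₗ[ℂ] A) : Prop where
  mem : ∀ a, E a ∈ B
  fix : ∀ b ∈ B, E b = b
  mul_left : ∀ b ∈ B, ∀ a, E (b * a) = b * E a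
  mul_right : ∀ b ∈ B, ∀ a, E (a * b) = E a * b
  positive : ∀ a, ∃ c : A, E (star a * a) = star c * c

/-- `{l_1, …, l_n}` is a quasi-basis for `E`. -/
def IsQuasiBasis (E : A →ₗ[ℂ] A) {n : ℕ} (l : Fin n → A) : Prop :=
  ∀ x, x = ∑ i, E (x * l i) * star (l i) ∧ x = ∑ i, l i * E (star (l i) * x)

/-- `E` has finite index, i.e. it has a (finite) quasi-basis. -/
def HasFiniteIndex (E : A →ₗ[ℂ] A) : Prop :=
  ∃ n, ∃ l : Fin n → A, IsQuasiBasis E l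

open Classical in
/-- The size of a chosen quasi-basis of `E` (zero if there is none). -/
def quasiSize (E : A →ₗ[ℂ] A) : ℕ :=
  if h : HasFiniteIndex E then h.choose else 0

open Classical in
/-- A chosen quasi-basis of `E` (if there is one). -/
def quasiBasis (E : A →ₗ[ℂ] A) : Fin (quasiSize E) → A :=
  if h : ∃ l : Fin (quasiSize E) → A, IsQuasiBasis E l then h.choose else 0

theorem isQuasiBasis_quasiBasis {E : A →ₗ[ℂ] A} (hE : HasFiniteIndex E) :
    IsQuasiBasis E (quasiBasis E) := by
  have h : ∃ l : Fin (quasiSize E) → A, IsQuasiBasis E l := by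
    rw [quasiSize, dif_pos hE]
    exact hE.choose_spec
  rw [quasiBasis, dif_pos h]
  exact h.choose_spec

/-- The Watatani index `Ind(E) = ∑ λ_i λ_i^*`; it does not depend on the quasi-basis. -/
def watataniIndex (E : A →ₗ[ℂ] A) : A :=
  ∑ i, quasiBasis E i * star (quasiBasis E i)

theorem IsQuasiBasis.index_eq {E : A →ₗ[ℂ] A} {n : ℕ} {l : Fin n → A} (hl : IsQuasiBasis E l) :
    watataniIndex E = ∑ i, l i * star (l i) := by
  have hm := isQuasiBasis_quasiBasis ⟨n, l, hl⟩
  calc watataniIndex E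
      = ∑ i, (∑ j, l j * E (star (l j) * quasiBasis E i)) * star (quasiBasis E i) :=
        Finset.sum_congr rfl fun i _ => by rw [← (hl _).2]
    _ = ∑ j, l j * ∑ i, E (star (l j) * quasiBasis E i) * star (quasiBasis E i) := by
        simp only [Finset.sum_mul, Finset.mul_sum, mul_assoc]
        exact Finset.sum_comm
    _ = ∑ j, l j * star (l j) :=
        Finset.sum_congr rfl fun j _ => by rw [← (hm _).1]

/-- The element `x e y` of the basic construction of `E : A → B`, acting on the Hilbert
`B`-module `A` (with `⟨a, a'⟩_B = E(a^* a')`). Here `e = e_B` is the Jones projection, which is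
`E` itself regarded as an operator on `A`, and `A` acts on itself by left multiplication. -/
def xey (E : A →ₗ[ℂ] A) (x y : A) : Module.End ℂ A :=
  LinearMap.mulLeft ℂ x * E * LinearMap.mulLeft ℂ y

/-- The C*-basic construction `A_1 = A e_B A` of a finite-index conditional expectation `E`,
as a space of operators on `A`. -/
def basicConstruction (E : A →ₗ[ℂ] A) : Submodule ℂ (Module.End ℂ A) :=
  Submodule.span ℂ (Set.range fun p : A × A => xey E p.1 p.2)

/-- The dual conditional expectation `E_1`, that is, the linear map on the basic construction
with `E_1(x e y) = Ind(E)⁻¹ x y`. It is given by the formula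
`T ↦ Ind(E)⁻¹ ∑ T(λ_i) λ_i^*`, which makes sense for all operators `T` on `A` but is only used
on the basic construction. -/
def dualExpectation (E : A →ₗ[ℂ] A) : Module.End ℂ A →ₗ[ℂ] A where
  toFun T := Ring.inverse (watataniIndex E) * ∑ i, T (quasiBasis E i) * star (quasiBasis E i)
  map_add' S T := by
    simp only [LinearMap.add_apply, add_mul, Finset.sum_add_distrib, mul_add]
  map_smul' c T := by
    simp only [LinearMap.smul_apply, smul_mul_assoc, ← Finset.smul_sum, mul_smul_comm,
      RingHom.id_apply]

theorem dualExpectation_xey {E : A →ₗ[ℂ] A} (hE : HasFiniteIndex E) (x y : A) :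
    dualExpectation E (xey E x y) = Ring.inverse (watataniIndex E) * (x * y) := by
  change _ * ∑ i, x * E (y * quasiBasis E i) * star (quasiBasis E i) = _
  simp only [mul_assoc x, ← Finset.mul_sum]
  rw [← (isQuasiBasis_quasiBasis hE y).1]

theorem dualExpectation_unique {E : A →ₗ[ℂ] A} (hE : HasFiniteIndex E)
    (f : Module.End ℂ A →ₗ[ℂ] A)
    (hf : ∀ x y, f (xey E x y) = Ring.inverse (watataniIndex E) * (x * y))
    {T : Module.End ℂ A} (hT : T ∈ basicConstruction E) : f T = dualExpectation E T := by
  refine LinearMap.eqOn_span (s := Set.range fun p : A × A => xey E p.1 p.2) ?_ hT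
  rintro _ ⟨p, rfl⟩
  rw [hf, dualExpectation_xey hE]

open Classical in
/-- The adjoint of the operator `T` on `A` with respect to the `B`-valued inner product
`⟨a, a'⟩_B = E(a^* a')` (if `T` is adjointable). -/
def adjointOf (E : A →ₗ[ℂ] A) (T : Module.End ℂ A) : Module.End ℂ A :=
  if h : ∃ S : Module.End ℂ A, ∀ x y, E (star (T x) * y) = E (star x * S y) then h.choose else 0

/-- The `A`-valued inner product `⟨S, T⟩_A = E_1(S^* T)` on the basic construction. -/
def innerA (E : A →ₗ[ℂ] A) (S T : Module.End ℂ A) : A :=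
  dualExpectation E (adjointOf E S * T)

/-- The norm `‖T‖_{A_1} = ‖E_1(T^* T)‖^{1/2}` on the basic construction. -/
def normA1 (E : A →ₗ[ℂ] A) (T : Module.End ℂ A) : ℝ := √‖innerA E T T‖

/-- `F` is a conditional expectation of `A` onto `C` with `E = E|_C ∘ F`. -/
def IsCompatible (E : A →ₗ[ℂ] A) (C : StarSubalgebra ℂ A) (F : A →ₗ[ℂ] A) : Prop :=
  IsConditionalExpectation C F ∧ ∀ a, E (F a) = E a

/-- `IMS(B, A, E)`: the intermediate C*-subalgebras `B ⊆ C ⊆ A` that admit a conditional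
expectation `F : A → C` with `E = E|_C ∘ F`. -/
def IMS (B : StarSubalgebra ℂ A) (E : A →ₗ[ℂ] A) : Set (StarSubalgebra ℂ A) :=
  {C | IsClosed (C : Set A) ∧ B ≤ C ∧ ∃ F, IsCompatible E C F}

open Classical in
/-- The Jones projection `e_C` of `C ∈ IMS(B, A, E)`: the compatible (hence unique) conditional
expectation of `A` onto `C`, regarded as an operator on `A`. -/
def jones (E : A →ₗ[ℂ] A) (C : StarSubalgebra ℂ A) : Module.End ℂ A :=
  if h : ∃ F, IsCompatible E C F then h.choose else 0

/-- The interior angle `α(C, D) ∈ [0, π/2]` between `C, D ∈ IMS(B, A, E) \ {B}` with respect to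
a finite-index conditional expectation `E : A → B`. -/
def interiorAngle (E : A →ₗ[ℂ] A) (C D : StarSubalgebra ℂ A) : ℝ :=
  Real.arccos (‖innerA E (jones E C - E) (jones E D - E)‖ /
    (normA1 E (jones E C - E) * normA1 E (jones E D - E)))

end Angles

/-! ### Intermediate crossed products -/

section Intermediate

variable {P : Type u} [CStarAlgebra P] {G : Type v} [Group G] {α : G →* (P ≃⋆ₐ[ℂ] P)}

/-- The canonical image of the crossed product of `P` by the subgroup `K` in the crossed product
of `P` by `G` (the completion of `C_c(G, P)` for `N`): the closure of `C_c(K, P)`. -/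
def crossedSub (N : CStarSeminorm (Cc α)) (K : Subgroup G) : StarSubalgebra ℂ N.Compl :=
  (N.ι.comp (Cc.incl α K)).range.topologicalClosure

/-- `E` is the conditional expectation of the crossed product by `G` onto the crossed product by
`H` that extends the map `∑ a_g g ↦ ∑_{h ∈ H} a_h h` on `C_c(G, P)`. -/
def IsCanonicalExpectation (N : CStarSeminorm (Cc α)) (H : Subgroup G)
    (E : N.Compl →ₗ[ℂ] N.Compl) : Prop :=
  IsConditionalExpectation (crossedSub N H) E ∧
    ∀ x : Cc α, E (N.ι x) = N.ι (Cc.restrict α H x)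

/-- The conjugate subgroup `g⁻¹ K g`. -/
def conjSubgroup (g : G) (K : Subgroup G) : Subgroup G :=
  K.map (MulAut.conj g⁻¹).toMonoidHom

end Intermediate

end

/-! For a subgroup L between H and G, discarding the coefficients outside L extends to an
expectation onto the crossed product by L, and this expectation is the Jones projection e_L.
Splitting K into cosets qH gives e_K = ∑ u_q e_B u_q^*, where u_q is the unitary of a coset
representative (`Cc.restrict_eq_sum`, `expectation_eq_sum`). For K = G this says that the u_q form a
quasi-basis, so Ind(E) = [G:H]; applying E_1 term by term gives the scalar E_1(e_K) = [K:H]/[G:H]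
(`dualExpectation_expectation`).

Since e_K e_D = e_{K∩D}, the product (e_K − e_B)(e_D − e_B) equals e_{K∩D} − e_B, and E_1 sends it
to ([K∩D:H] − 1)/[G:H] (`innerA_expectation_sub`). If g normalizes H and D = g⁻¹Kg, then [D:H] =
[K:H], so the cosine of the angle is ([K∩D:H] − 1)/([K:H] − 1). It is 1 exactly when K∩D exhausts
both K and D, that is, when D = K (`relIndex_le_relIndex_inf_conjSubgroup_iff`).

This argument only needs a C*-seminorm with N(1) ≠ 0 for which restriction to each L ≥ H is
contractive (`angle_theorem_of_contractive`). For the reduced norm, contractivity holds for every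
subgroup: finite compressions over L are compressions over G, and ℓ²(G) splits over the right cosets
of L. For the universal norm, finite index allows a representation of C_c(L, P) to be induced to one
of C_c(G, P), of which it is a corner. -/

noncomputable section CanonicalExpectations

variable {P : Type u} [CStarAlgebra P] {G : Type v} [Group G]

/-! ### Coefficient calculus in C_c(G, P) -/

namespace Cc

variable (α : G →* (P ≃⋆ₐ[ℂ] P))

/-- The canonical unitary of `C_c(G, P)` associated with a group element. -/
def unitary (s : G) : Cc α := single α s 1

theorem unitary_one : unitary α 1 = 1 := rfl

theorem star_unitary (s : G) : star (unitary α s) = unitary α s⁻¹ := by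
  simp [unitary, star_single]

theorem unitary_mul (s t : G) : unitary α s * unitary α t = unitary α (s * t) := by
  simp [unitary, single_mul_single]

theorem unitary_mul_single (s t : G) (a : P) :
    unitary α s * single α t a = single α (s * t) (α s a) := by
  simp [unitary, single_mul_single]

open Classical in
theorem restrict_single_mem {L : Subgroup G} {s : G} (hs : s ∈ L) (a : P) :
    restrict α L (single α s a) = single α s a :=
  Finsupp.filter_single_of_pos _ hs

open Classical in
theorem restrict_single_notMem {L : Subgroup G} {s : G} (hs : s ∉ L) (a : P) :
    restrict α L (single α s a) = 0 :=
  Finsupp.filter_single_of_neg _ hs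

open Classical in
/-- Restriction of the support to a subgroup, as a linear map. -/
def restrictₗ (L : Subgroup G) : Cc α →ₗ[ℂ] Cc α where
  toFun := restrict α L
  map_add' _ _ := Finsupp.filter_add
  map_smul' _ _ := Finsupp.filter_smul

theorem restrict_add (L : Subgroup G) (x y : Cc α) :
    restrict α L (x + y) = restrict α L x + restrict α L y := map_add (restrictₗ α L) x y

theorem restrict_zero (L : Subgroup G) : restrict α L (0 : Cc α) = 0 := map_zero (restrictₗ α L)

theorem incl_single {L : Subgroup G} (k : L) (a : P) :
    incl α L (single (res α L) k a) = single α (k : G) a := inclHom_single α L k a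

theorem restrict_incl (L : Subgroup G) (y : Cc (res α L)) :
    restrict α L (incl α L y) = incl α L y := by
  induction y using induction_on with
  | h0 => simp [restrict_zero]
  | hadd x x' h h' => rw [map_add, restrict_add, h, h']
  | hs r a => rw [incl_single, restrict_single_mem α r.2]

/-- Restriction of functions on `G` to a subgroup, with values in `C_c(L, P)`. -/
def resHom (L : Subgroup G) : Cc α →ₗ[ℂ] Cc (res α L) where
  toFun x := Finsupp.comapDomain ((↑) : L → G) (show G →₀ P from x) Subtype.val_injective.injOn
  map_add' _ _ := Finsupp.comapDomain_add_of_injective Subtype.val_injective _ _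
  map_smul' _ _ := Finsupp.comapDomain_smul_of_injective Subtype.val_injective _ _

theorem coeff_resHom (L : Subgroup G) (x : Cc α) (s : L) :
    coeff (res α L) (resHom α L x) s = coeff α x (s : G) := rfl

variable {α} in
theorem coeff_ext {x y : Cc α} (h : ∀ s, coeff α x s = coeff α y s) : x = y := Finsupp.ext h

theorem coeff_single_self (s : G) (a : P) : coeff α (single α s a) s = a :=
  Finsupp.single_eq_same

theorem coeff_single_of_ne {s t : G} (h : t ≠ s) (a : P) : coeff α (single α s a) t = 0 :=
  Finsupp.single_eq_of_ne h

theorem coeff_add (x y : Cc α) (s : G) : coeff α (x + y) s = coeff α x s + coeff α y s := rfl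

theorem coeff_zero (s : G) : coeff α (0 : Cc α) s = 0 := rfl

theorem resHom_single_mem {L : Subgroup G} {s : G} (hs : s ∈ L) (a : P) :
    resHom α L (single α s a) = single (res α L) ⟨s, hs⟩ a := by
  refine coeff_ext fun t => ?_
  rw [coeff_resHom]
  by_cases h : (t : G) = s
  · subst h
    rw [coeff_single_self, coeff_single_self]
  · rw [coeff_single_of_ne _ h, coeff_single_of_ne _ fun h' => h (congrArg Subtype.val h')]

theorem resHom_single_notMem {L : Subgroup G} {s : G} (hs : s ∉ L) (a : P) :
    resHom α L (single α s a) = 0 := by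
  refine coeff_ext fun t => ?_
  rw [coeff_resHom, coeff_single_of_ne _ fun h => hs (by rw [← h]; exact t.2)]
  rfl

theorem resHom_incl (L : Subgroup G) (y : Cc (res α L)) : resHom α L (incl α L y) = y := by
  induction y using induction_on with
  | h0 => simp
  | hadd x x' h h' => rw [map_add, map_add, h, h']
  | hs r a => rw [incl_single, resHom_single_mem α r.2]

theorem incl_resHom (L : Subgroup G) (x : Cc α) :
    incl α L (resHom α L x) = restrict α L x := by
  induction x using induction_on with
  | h0 => simp [restrict_zero]
  | hadd x x' h h' => rw [map_add, map_add, restrict_add, h, h']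
  | hs r a =>
    by_cases hr : r ∈ L
    · rw [resHom_single_mem α hr, incl_single, restrict_single_mem α hr]
    · rw [resHom_single_notMem α hr, restrict_single_notMem α hr, map_zero]

/-- Left translation by an element of L preserves both L and its complement. This is the bimodule
property of the expectation at the algebraic level. -/
theorem resHom_incl_mul (L : Subgroup G) (y : Cc (res α L)) (x : Cc α) :
    resHom α L (incl α L y * x) = y * resHom α L x := by
  induction x using induction_on with
  | h0 => simp
  | hadd x x' h h' => simp only [mul_add, map_add, h, h']
  | hs s b =>
    induction y using induction_on with
    | h0 => simp
    | hadd x x' h h' => simp only [map_add, add_mul, h, h']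
    | hs r a =>
      rw [incl_single, single_mul_single]
      by_cases hs : s ∈ L
      · rw [resHom_single_mem α hs, resHom_single_mem α (mul_mem r.2 hs), single_mul_single]
        rfl
      · rw [resHom_single_notMem α hs, mul_zero, resHom_single_notMem α]
        rwa [Subgroup.mul_mem_cancel_left _ r.2]

theorem star_resHom (L : Subgroup G) (x : Cc α) :
    star (resHom α L x) = resHom α L (star x) := by
  induction x using induction_on with
  | h0 => simp
  | hadd x x' h h' => simp only [map_add, star_add, h, h']
  | hs r a =>
    rw [star_single]
    by_cases hr : r ∈ L
    · rw [resHom_single_mem α hr, resHom_single_mem α (inv_mem hr), star_single]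
      rfl
    · rw [resHom_single_notMem α hr, resHom_single_notMem α (by simpa using hr), star_zero]

theorem resHom_mul_incl (L : Subgroup G) (x : Cc α) (y : Cc (res α L)) :
    resHom α L (x * incl α L y) = resHom α L x * y := by
  rw [← star_star (x * incl α L y), ← star_resHom, star_mul, ← map_star (incl α L) y,
    resHom_incl_mul, star_mul, star_star, star_resHom, star_star]

theorem restrict_incl_mul (L : Subgroup G) (y : Cc (res α L)) (x : Cc α) :
    restrict α L (incl α L y * x) = incl α L y * restrict α L x := by
  rw [← incl_resHom, resHom_incl_mul, map_mul, incl_resHom]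

theorem star_restrict (L : Subgroup G) (x : Cc α) :
    restrict α L (star x) = star (restrict α L x) := by
  rw [← incl_resHom, ← star_resHom, map_star, incl_resHom]

theorem restrict_restrict (L M : Subgroup G) (x : Cc α) :
    restrict α L (restrict α M x) = restrict α (L ⊓ M) x := by
  induction x using induction_on with
  | h0 => simp only [restrict_zero]
  | hadd x x' h h' => simp only [restrict_add, h, h']
  | hs r a =>
    by_cases hM : r ∈ M
    · rw [restrict_single_mem α hM]
      by_cases hL : r ∈ L
      · rw [restrict_single_mem α hL, restrict_single_mem α (L := L ⊓ M) ⟨hL, hM⟩]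
      · rw [restrict_single_notMem α hL,
          restrict_single_notMem α (L := L ⊓ M) fun h => hL h.1]
    · rw [restrict_single_notMem α hM, restrict_zero,
        restrict_single_notMem α (L := L ⊓ M) fun h => hM h.2]

theorem restrict_top (x : Cc α) : restrict α ⊤ x = x := by
  induction x using induction_on with
  | h0 => rw [restrict_zero]
  | hadd x x' h h' => rw [restrict_add, h, h']
  | hs r a => rw [restrict_single_mem α (Subgroup.mem_top r)]

/-- An s in K lies in exactly one coset qH; only that summand survives the restriction to H, and it
gives back a s. An s outside K is killed by every summand. This is the source of e_K = ∑ u_q e_B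
u_q^*. -/
theorem restrict_eq_sum {H K : Subgroup G} (hHK : H ≤ K) [Fintype (K ⧸ H.subgroupOf K)]
    (x : Cc α) :
    restrict α K x = ∑ q : K ⧸ H.subgroupOf K,
      unitary α (q.out : G) * restrict α H (star (unitary α (q.out : G)) * x) := by
  induction x using induction_on with
  | h0 => simp [restrict_zero]
  | hadd x x' h h' => simp only [mul_add, restrict_add, Finset.sum_add_distrib, h, h']
  | hs s a =>
    simp only [star_unitary, unitary_mul_single]
    by_cases hs : s ∈ K
    · rw [restrict_single_mem α hs, Finset.sum_eq_single (QuotientGroup.mk ⟨s, hs⟩)]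
      · have h : ((QuotientGroup.mk ⟨s, hs⟩ : K ⧸ H.subgroupOf K).out : G)⁻¹ * s ∈ H :=
          Subgroup.mem_subgroupOf.1 (QuotientGroup.eq.1 (QuotientGroup.out_eq' (QuotientGroup.mk
            ⟨s, hs⟩ : K ⧸ H.subgroupOf K)))
        rw [restrict_single_mem α h, unitary_mul_single, mul_inv_cancel_left, apply_apply_inv]
      · intro q _ hq
        rw [restrict_single_notMem, mul_zero]
        intro h
        refine hq ?_
        rw [← QuotientGroup.out_eq' q]
        exact QuotientGroup.eq.2 h
      · simp
    · rw [restrict_single_notMem α hs]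
      refine (Finset.sum_eq_zero fun q _ => ?_).symm
      rw [restrict_single_notMem, mul_zero]
      intro h
      exact hs ((Subgroup.mul_mem_cancel_left _ (inv_mem q.out.2)).1 (hHK h))

end Cc

/-! ### Extension of the expectations to the completion -/

variable {α : G →* (P ≃⋆ₐ[ℂ] P)} (N : CStarSeminorm (Cc α))

/-- The extension to the completion of the map `∑ a_g g ↦ ∑_{l ∈ L} a_l l`. -/
def expectation (L : Subgroup G) (h : ∀ x, N (Cc.restrict α L x) ≤ N x) :
    N.Compl →L[ℂ] N.Compl :=
  (LinearMap.mkContinuous (E := N.Pre) (N.ι.toAlgHom.toLinearMap.comp (Cc.restrictₗ α L)) 1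
    fun x => by rw [one_mul]; exact (N.norm_ι _).trans_le (h x)).extend
    (UniformSpace.Completion.toComplL (𝕜 := ℂ) (E := N.Pre))

section

variable {N} {L : Subgroup G} (hL : ∀ x, N (Cc.restrict α L x) ≤ N x)

theorem expectation_ι (x : Cc α) : expectation N L hL (N.ι x) = N.ι (Cc.restrict α L x) :=
  ContinuousLinearMap.extend_eq _ (UniformSpace.Completion.denseRange_coe (α := N.Pre))
    (UniformSpace.Completion.isUniformInducing_coe N.Pre) (show N.Pre from x)

theorem ι_induction {p : N.Compl → Prop} (hp : IsClosed {x | p x}) (h : ∀ x, p (N.ι x))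
    (x : N.Compl) : p x := N.denseRange_ι.induction_on x hp h

theorem ι_incl_mem (L : Subgroup G) (y : Cc (Cc.res α L)) :
    N.ι (Cc.incl α L y) ∈ crossedSub N L :=
  StarSubalgebra.le_topologicalClosure _ ⟨y, rfl⟩

theorem isClosed_crossedSub (L : Subgroup G) : IsClosed (crossedSub N L : Set N.Compl) :=
  StarSubalgebra.isClosed_topologicalClosure _

theorem crossedSub_induction {p : N.Compl → Prop} (hp : IsClosed {x | p x})
    (h : ∀ y, p (N.ι (Cc.incl α L y))) {x : N.Compl} (hx : x ∈ crossedSub N L) : p x := by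
  refine closure_minimal ?_ hp hx
  rintro _ ⟨y, rfl⟩
  exact h y

theorem crossedSub_ext {f g : N.Compl → N.Compl} (hf : Continuous f) (hg : Continuous g)
    (h : ∀ y, f (N.ι (Cc.incl α L y)) = g (N.ι (Cc.incl α L y))) {x : N.Compl}
    (hx : x ∈ crossedSub N L) : f x = g x :=
  crossedSub_induction (p := fun x => f x = g x) (isClosed_eq hf hg) h hx

theorem crossedSub_mono {L M : Subgroup G} (h : L ≤ M) : crossedSub N L ≤ crossedSub N M := by
  intro x hx
  refine crossedSub_induction (isClosed_crossedSub M) (fun y => ?_) hx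
  have : Cc.incl α L y = Cc.incl α M (Cc.resHom α M (Cc.incl α L y)) := by
    rw [Cc.incl_resHom, ← Cc.restrict_incl, Cc.restrict_restrict, inf_eq_right.2 h]
  rw [this]
  exact ι_incl_mem M _

theorem unitary_mem_crossedSub {s : G} (hs : s ∈ L) : N.ι (Cc.unitary α s) ∈ crossedSub N L := by
  have := ι_incl_mem (N := N) L (Cc.single _ ⟨s, hs⟩ 1)
  rwa [Cc.incl_single] at this

theorem expectation_mem (x : N.Compl) : expectation N L hL x ∈ crossedSub N L := by
  refine ι_induction ((isClosed_crossedSub L).preimage (expectation N L hL).continuous)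
    (fun x => ?_) x
  rw [expectation_ι, ← Cc.incl_resHom]
  exact ι_incl_mem L _

theorem expectation_fix {b : N.Compl} (hb : b ∈ crossedSub N L) : expectation N L hL b = b := by
  refine crossedSub_ext (f := expectation N L hL) (g := id) (by fun_prop) (by fun_prop) (fun y => ?_) hb
  rw [expectation_ι, Cc.restrict_incl, id]

theorem expectation_mul_left {b : N.Compl} (hb : b ∈ crossedSub N L) (x : N.Compl) :
    expectation N L hL (b * x) = b * expectation N L hL x := by
  refine crossedSub_ext (f := fun b => expectation N L hL (b * x))
    (g := fun b => b * expectation N L hL x) (by fun_prop) (by fun_prop) (fun y => ?_) hb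
  induction x using ι_induction with
  | hp => exact isClosed_eq (by fun_prop) (by fun_prop)
  | h x =>
    rw [← map_mul, expectation_ι, expectation_ι, ← map_mul, Cc.restrict_incl_mul]

theorem expectation_star (x : N.Compl) :
    expectation N L hL (star x) = star (expectation N L hL x) := by
  induction x using ι_induction with
  | hp =>
    exact isClosed_eq ((expectation N L hL).continuous.comp N.continuous_star)
      (N.continuous_star.comp (expectation N L hL).continuous)
  | h x =>
    rw [← map_star, expectation_ι, expectation_ι, ← map_star, Cc.star_restrict]

theorem expectation_mul_right {b : N.Compl} (hb : b ∈ crossedSub N L) (x : N.Compl) :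
    expectation N L hL (x * b) = expectation N L hL x * b := by
  rw [← star_star (x * b), expectation_star, star_mul, expectation_mul_left _ (star_mem hb),
    expectation_star, star_mul, star_star, star_star]

theorem expectation_expectation {M : Subgroup G} (hM : ∀ x, N (Cc.restrict α M x) ≤ N x)
    (hLM : ∀ x, N (Cc.restrict α (L ⊓ M) x) ≤ N x) (x : N.Compl) :
    expectation N L hL (expectation N M hM x) = expectation N (L ⊓ M) hLM x := by
  induction x using ι_induction with
  | hp => exact isClosed_eq (by fun_prop) (by fun_prop)
  | h x =>
    rw [expectation_ι, expectation_ι, expectation_ι, Cc.restrict_restrict]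

theorem expectation_expectation_of_le {M : Subgroup G} (hM : ∀ x, N (Cc.restrict α M x) ≤ N x)
    (h : L ≤ M) (x : N.Compl) :
    expectation N L hL (expectation N M hM x) = expectation N L hL x := by
  induction x using ι_induction with
  | hp => exact isClosed_eq (by fun_prop) (by fun_prop)
  | h x =>
    rw [expectation_ι, expectation_ι, expectation_ι, Cc.restrict_restrict, inf_eq_left.2 h]

theorem ι_unitary_mul_star (s : G) : N.ι (Cc.unitary α s) * star (N.ι (Cc.unitary α s)) = 1 := by
  rw [← map_star, ← map_mul, Cc.star_unitary, Cc.unitary_mul, mul_inv_cancel, Cc.unitary_one,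
    map_one]

theorem expectation_eq_sum {K : Subgroup G} (hK : ∀ x, N (Cc.restrict α K x) ≤ N x)
    (h : L ≤ K) [Fintype (K ⧸ L.subgroupOf K)] (x : N.Compl) :
    expectation N K hK x = ∑ q : K ⧸ L.subgroupOf K, N.ι (Cc.unitary α (q.out : G)) *
      expectation N L hL (star (N.ι (Cc.unitary α (q.out : G))) * x) := by
  induction x using ι_induction with
  | hp => exact isClosed_eq (by fun_prop) (by fun_prop)
  | h x =>
    simp only [← map_star, ← map_mul, expectation_ι, ← map_sum]
    rw [Cc.restrict_eq_sum α h]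

/-- The case K = G of `expectation_eq_sum`; this is why cosets are taken inside `⊤`. -/
theorem eq_sum_unitary_mul_expectation [Fintype ((⊤ : Subgroup G) ⧸ L.subgroupOf ⊤)]
    (x : N.Compl) :
    x = ∑ q : (⊤ : Subgroup G) ⧸ L.subgroupOf ⊤, N.ι (Cc.unitary α (q.out : G)) *
      expectation N L hL (star (N.ι (Cc.unitary α (q.out : G))) * x) := by
  have htop : ∀ x, N (Cc.restrict α ⊤ x) ≤ N x := fun x => by rw [Cc.restrict_top]
  rw [← expectation_eq_sum hL htop le_top]
  induction x using ι_induction with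
  | hp => exact isClosed_eq (by fun_prop) (by fun_prop)
  | h x =>
    rw [expectation_ι, Cc.restrict_top]

/-- Expanding only the right factor x in the coset unitaries turns E(x^*x) into a sum of squares, so
positivity of E follows from finite index by pure algebra. -/
theorem expectation_star_mul_self [Fintype ((⊤ : Subgroup G) ⧸ L.subgroupOf ⊤)] (x : N.Compl) :
    expectation N L hL (star x * x) = ∑ q : (⊤ : Subgroup G) ⧸ L.subgroupOf ⊤,
      star (expectation N L hL (star (N.ι (Cc.unitary α (q.out : G))) * x)) *
        expectation N L hL (star (N.ι (Cc.unitary α (q.out : G))) * x) := by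
  conv_lhs => enter [2, 2]; rw [eq_sum_unitary_mul_expectation hL x]
  rw [Finset.mul_sum, map_sum]
  refine Finset.sum_congr rfl fun q _ => ?_
  rw [← mul_assoc, expectation_mul_right _ (expectation_mem _ _), ← expectation_star, star_mul,
    star_star]

theorem isCanonicalExpectation_expectation [L.FiniteIndex] :
    IsCanonicalExpectation N L (expectation N L hL : N.Compl →ₗ[ℂ] N.Compl) := by
  refine ⟨⟨expectation_mem hL, fun b hb => expectation_fix hL hb,
    fun b hb => expectation_mul_left hL hb, fun b hb => expectation_mul_right hL hb,
    fun x => ?_⟩, expectation_ι hL⟩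
  have : Fintype ((⊤ : Subgroup G) ⧸ L.subgroupOf ⊤) := Fintype.ofFinite _
  let _ := CStarAlgebra.spectralOrder N.Compl
  have _ := CStarAlgebra.spectralOrderedRing N.Compl
  rw [← CStarAlgebra.nonneg_iff_eq_star_mul_self]
  change 0 ≤ expectation N L hL _
  rw [expectation_star_mul_self]
  exact Finset.sum_nonneg fun q _ => star_mul_self_nonneg _

end

end CanonicalExpectations

/-! ### Uniqueness behind the chosen objects -/

section QuasiBasis

variable {A : Type*} [CStarAlgebra A]

/-- A positive linear map between C*-algebras is automatically bounded. Hence an expectation is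
determined by its values on the dense image of C_c(G, P). -/
theorem IsConditionalExpectation.continuous {B : StarSubalgebra ℂ A} {E : A →ₗ[ℂ] A}
    (hE : IsConditionalExpectation B E) : Continuous E := by
  let _ := CStarAlgebra.spectralOrder A
  have _ := CStarAlgebra.spectralOrderedRing A
  have h : ∀ a, 0 ≤ a → 0 ≤ E a := fun a ha => by
    obtain ⟨b, rfl⟩ := CStarAlgebra.nonneg_iff_eq_star_mul_self.1 ha
    exact CStarAlgebra.nonneg_iff_eq_star_mul_self.2 (hE.positive b)
  exact map_continuous (PositiveLinearMap.mk₀ E h)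

/-- `adjointOf` is defined by choice; nondegeneracy of the B-valued inner product makes the choice
unique. -/
theorem adjointOf_eq {E : A →ₗ[ℂ] A} (hE : ∀ z, (∀ x, E (star x * z) = 0) → z = 0)
    {S T : Module.End ℂ A} (h : ∀ x y, E (star (T x) * y) = E (star x * S y)) :
    adjointOf E T = S := by
  have hex : ∃ S : Module.End ℂ A, ∀ x y, E (star (T x) * y) = E (star x * S y) := ⟨S, h⟩
  rw [adjointOf, dif_pos hex]
  ext y
  rw [← sub_eq_zero]
  refine hE _ fun x => ?_
  rw [mul_sub, map_sub, ← h, ← hex.choose_spec, sub_self]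

theorem jones_eq {E F : A →ₗ[ℂ] A} {C : StarSubalgebra ℂ A} (hF : IsCompatible E C F)
    (h : ∀ F', IsCompatible E C F' → F' = F) : jones E C = F := by
  have hex : ∃ F, IsCompatible E C F := ⟨F, hF⟩
  rw [jones, dif_pos hex]
  exact h _ hex.choose_spec

end QuasiBasis

/-! ### Indices of conjugate subgroups -/

section SubgroupLemmas

variable {G : Type v} [Group G]

theorem conjSubgroup_eq_self_iff {g : G} {K : Subgroup G} :
    conjSubgroup g K = K ↔ g ∈ Subgroup.normalizer (K : Set G) := by
  rw [← inv_mem_iff (x := g), Subgroup.mem_normalizer_iff_map_conj_eq]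
  rfl

/-- Conjugation by g⁻¹ fixes H and carries K to g⁻¹Kg. -/
theorem relIndex_conjSubgroup {g : G} {H : Subgroup G} (K : Subgroup G)
    (hg : g ∈ Subgroup.normalizer (H : Set G)) :
    H.relIndex (conjSubgroup g K) = H.relIndex K := by
  conv_lhs => rw [← conjSubgroup_eq_self_iff.2 hg]
  exact Subgroup.relIndex_map_map_of_injective H K (MulAut.conj g⁻¹).injective

theorem relIndex_ne_zero_of_finiteIndex (H K : Subgroup G) [H.FiniteIndex] :
    H.relIndex K ≠ 0 :=
  (Subgroup.isFiniteRelIndex_of_finiteIndex (K := K)).relIndex_ne_zero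

/-- The tower law [K∩D:H][K:K∩D] = [K:H], with all indices finite and nonzero, forces [K:K∩D] = 1.
-/
theorem le_of_relIndex_le {H K D : Subgroup G} [H.FiniteIndex] (hK : H ≤ K) (hD : H ≤ D)
    (h : H.relIndex K ≤ H.relIndex (K ⊓ D)) : K ≤ D := by
  have h1 := Subgroup.relIndex_mul_relIndex H (K ⊓ D) K (le_inf hK hD) inf_le_left
  have h0 : 0 < H.relIndex (K ⊓ D) := Nat.pos_of_ne_zero (relIndex_ne_zero_of_finiteIndex _ _)
  have h2 : 0 < (K ⊓ D).relIndex K := by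
    refine Nat.pos_of_ne_zero fun h => ?_
    rw [h, mul_zero] at h1
    exact relIndex_ne_zero_of_finiteIndex _ _ h1.symm
  have h3 : (K ⊓ D).relIndex K = 1 := by nlinarith
  exact (Subgroup.relIndex_eq_one.1 h3).trans inf_le_right

theorem relIndex_le_relIndex_inf_conjSubgroup_iff {g : G} {H K : Subgroup G} [H.FiniteIndex]
    (hK : H ≤ K) (hg : g ∈ Subgroup.normalizer (H : Set G)) :
    H.relIndex K ≤ H.relIndex (K ⊓ conjSubgroup g K) ↔
      g ∈ Subgroup.normalizer (K : Set G) := by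
  have hD : H ≤ conjSubgroup g K := by
    conv_lhs => rw [← conjSubgroup_eq_self_iff.2 hg]
    exact Subgroup.map_mono hK
  rw [← conjSubgroup_eq_self_iff]
  refine ⟨fun h => ?_, fun h => by rw [h, inf_idem]⟩
  have h1 := le_of_relIndex_le hK hD h
  -- From K ≤ g⁻¹Kg the reverse inclusion also follows by counting, as both groups have the same
  -- index over H.
  refine le_antisymm (le_of_relIndex_le hD hK ?_) h1
  rw [relIndex_conjSubgroup K hg, inf_eq_right.2 h1]

end SubgroupLemmas

/-! ### Jones projections, the dual expectation and the angle -/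

noncomputable section AngleFormula

variable {P : Type u} [CStarAlgebra P] {G : Type v} [Group G]
variable {α : G →* (P ≃⋆ₐ[ℂ] P)} {N : CStarSeminorm (Cc α)}

theorem IsCanonicalExpectation.eq_expectation {H : Subgroup G} {E : N.Compl →ₗ[ℂ] N.Compl}
    (hE : IsCanonicalExpectation N H E) (hH : ∀ x, N (Cc.restrict α H x) ≤ N x) :
    E = (expectation N H hH : N.Compl →ₗ[ℂ] N.Compl) := by
  ext x
  have hc := hE.1.continuous
  induction x using ι_induction with
  | hp => exact isClosed_eq hc (expectation N H hH).continuous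
  | h x => exact (hE.2 x).trans (expectation_ι hH x).symm

variable {H K D : Subgroup G} (hH : ∀ x, N (Cc.restrict α H x) ≤ N x)
  (hK : ∀ x, N (Cc.restrict α K x) ≤ N x) (hD : ∀ x, N (Cc.restrict α D x) ≤ N x)

/-- The canonical expectation as a linear map. -/
abbrev expectationₗ (H : Subgroup G) (hH : ∀ x, N (Cc.restrict α H x) ≤ N x) :
    Module.End ℂ N.Compl := (expectation N H hH : N.Compl →ₗ[ℂ] N.Compl)

/-- One quasi-basis identity is the coset expansion of x; the other is the adjoint of the expansion
of x^*. -/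
theorem isQuasiBasis_unitary [Fintype ((⊤ : Subgroup G) ⧸ H.subgroupOf ⊤)] :
    IsQuasiBasis (expectationₗ H hH)
      fun i => N.ι (Cc.unitary α (((Fintype.equivFin
        ((⊤ : Subgroup G) ⧸ H.subgroupOf ⊤)).symm i).out : G)) := by
  have key : ∀ x : N.Compl, x = ∑ i, N.ι (Cc.unitary α (((Fintype.equivFin
        ((⊤ : Subgroup G) ⧸ H.subgroupOf ⊤)).symm i).out : G)) *
      expectation N H hH (star (N.ι (Cc.unitary α (((Fintype.equivFin
        ((⊤ : Subgroup G) ⧸ H.subgroupOf ⊤)).symm i).out : G))) * x) := fun x => by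
    conv_lhs => rw [eq_sum_unitary_mul_expectation hH x]
    exact ((Fintype.equivFin ((⊤ : Subgroup G) ⧸ H.subgroupOf ⊤)).symm.sum_comp
      fun q => N.ι (Cc.unitary α (q.out : G)) *
        expectation N H hH (star (N.ι (Cc.unitary α (q.out : G))) * x)).symm
  refine fun x => ⟨?_, key x⟩
  rw [← star_star x]
  conv_lhs => rw [key (star x)]
  simp only [star_sum, star_mul, ← expectation_star, star_star]
  rfl

variable [H.FiniteIndex]

theorem hasFiniteIndex_expectation : HasFiniteIndex (expectationₗ H hH) := by
  have : Fintype ((⊤ : Subgroup G) ⧸ H.subgroupOf ⊤) := Fintype.ofFinite _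
  exact ⟨_, _, isQuasiBasis_unitary hH⟩

theorem watataniIndex_expectation :
    watataniIndex (expectationₗ H hH) = (H.index : ℂ) • 1 := by
  have : Fintype ((⊤ : Subgroup G) ⧸ H.subgroupOf ⊤) := Fintype.ofFinite _
  rw [(isQuasiBasis_unitary hH).index_eq]
  simp only [ι_unitary_mul_star, Finset.sum_const, Finset.card_univ, Fintype.card_fin]
  rw [← Nat.card_eq_fintype_card, ← Subgroup.relIndex_top_right H, Nat.cast_smul_eq_nsmul]
  rfl

theorem inverse_watataniIndex_expectation :
    Ring.inverse (watataniIndex (expectationₗ H hH)) = (H.index : ℂ)⁻¹ • 1 := by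
  rw [watataniIndex_expectation]
  have h : (H.index : ℂ) ≠ 0 := Nat.cast_ne_zero.2 Subgroup.FiniteIndex.index_ne_zero
  let u : N.Complˣ := ⟨(H.index : ℂ) • 1, (H.index : ℂ)⁻¹ • 1, by simp [smul_smul, h],
    by simp [smul_smul, h]⟩
  exact Ring.inverse_unit u

theorem expectation_nondegenerate {z : N.Compl}
    (hz : ∀ x, expectation N H hH (star x * z) = 0) : z = 0 := by
  have : Fintype ((⊤ : Subgroup G) ⧸ H.subgroupOf ⊤) := Fintype.ofFinite _
  rw [eq_sum_unitary_mul_expectation hH z]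
  simp [hz]

include hK in
theorem isCompatible_expectation (h : H ≤ K) :
    IsCompatible (expectationₗ H hH) (crossedSub N K) (expectationₗ K hK) := by
  have := Subgroup.finiteIndex_of_le h
  exact ⟨(isCanonicalExpectation_expectation hK).1, expectation_expectation_of_le hH hK h⟩

/-- Uniqueness of a compatible F: its values lie in the crossed product by K, so F x = ∑ u_q E(u_q^*
F x). Since u_q is in that algebra, E(u_q^* F x) = E(F(u_q^* x)) = E(u_q^* x), which no longer
involves F. -/
theorem jones_expectation (h : H ≤ K) :
    jones (expectationₗ H hH) (crossedSub N K) = expectationₗ K hK := by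
  refine jones_eq (isCompatible_expectation hH hK h) fun F hF => ?_
  have : Fintype (K ⧸ H.subgroupOf K) := Fintype.ofFinite _
  ext x
  change F x = expectation N K hK x
  rw [← expectation_fix hK (hF.1.mem x), expectation_eq_sum hH hK h, expectation_eq_sum hH hK h]
  refine Finset.sum_congr rfl fun q _ => ?_
  rw [← hF.1.mul_left _ (star_mem (unitary_mem_crossedSub q.out.2))]
  exact congrArg _ (hF.2 _)

-- Self-adjointness of e_K: inserting the expectation onto the crossed product by K under E turns
-- both sides into E(e_K(x)^* e_K(y)).
omit [H.FiniteIndex] in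
theorem expectation_star_mul_comm (h : H ≤ K) (x y : N.Compl) :
    expectation N H hH (star (expectation N K hK x) * y) =
      expectation N H hH (star x * expectation N K hK y) := by
  rw [← expectation_expectation_of_le hH hK h (star (expectation N K hK x) * y),
    expectation_mul_left hK (star_mem (expectation_mem hK x)),
    ← expectation_expectation_of_le hH hK h (star x * expectation N K hK y),
    expectation_mul_right hK (expectation_mem hK y), expectation_star]

theorem adjointOf_expectation_sub (h : H ≤ K) :
    adjointOf (expectationₗ H hH) (expectationₗ K hK - expectationₗ H hH) =
      expectationₗ K hK - expectationₗ H hH := by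
  refine adjointOf_eq (fun z hz => expectation_nondegenerate hH hz) fun x y => ?_
  change expectation N H hH (star (expectation N K hK x - expectation N H hH x) * y) =
    expectation N H hH (star x * (expectation N K hK y - expectation N H hH y))
  rw [star_sub, sub_mul, mul_sub, map_sub, map_sub, expectation_star_mul_comm hH hK h,
    expectation_star_mul_comm hH hH le_rfl]

/-- Each of the [K:H] terms u_q e_B u_q^* of e_K is sent by E_1 to Ind(E)⁻¹ u_q u_q^* = [G:H]⁻¹. -/
theorem dualExpectation_expectation (h : H ≤ K) :
    dualExpectation (expectationₗ H hH) (expectationₗ K hK) =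
      ((H.index : ℂ)⁻¹ * H.relIndex K) • 1 := by
  have : Fintype (K ⧸ H.subgroupOf K) := Fintype.ofFinite _
  have hsum : expectationₗ K hK = ∑ q : K ⧸ H.subgroupOf K, xey (expectationₗ H hH)
      (N.ι (Cc.unitary α (q.out : G))) (star (N.ι (Cc.unitary α (q.out : G)))) := by
    ext x
    rw [LinearMap.sum_apply]
    exact expectation_eq_sum hH hK h x
  rw [hsum, map_sum]
  simp only [dualExpectation_xey (hasFiniteIndex_expectation hH), ι_unitary_mul_star, mul_one,
    inverse_watataniIndex_expectation, Finset.sum_const, Finset.card_univ]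
  rw [← Nat.cast_smul_eq_nsmul ℂ, smul_smul, mul_comm, ← Nat.card_eq_fintype_card]
  rfl

theorem innerA_expectation_sub (hKD : ∀ x, N (Cc.restrict α (K ⊓ D) x) ≤ N x)
    (h : H ≤ K) (h' : H ≤ D) :
    innerA (expectationₗ H hH) (expectationₗ K hK - expectationₗ H hH)
      (expectationₗ D hD - expectationₗ H hH) =
      ((H.index : ℂ)⁻¹ * ((H.relIndex (K ⊓ D) : ℂ) - 1)) • 1 := by
  -- e_K e_D = e_{K∩D}, while e_K and e_D both absorb e_B, so the cross terms collapse to −e_B.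
  have hmul : (expectationₗ K hK - expectationₗ H hH) * (expectationₗ D hD - expectationₗ H hH) =
      expectationₗ (K ⊓ D) hKD - expectationₗ H hH := by
    have hHH : ∀ x, expectation N H hH (expectation N H hH x) = expectation N H hH x :=
      expectation_expectation_of_le hH hH le_rfl
    ext x
    change expectation N K hK (expectation N D hD x - expectation N H hH x) -
      expectation N H hH (expectation N D hD x - expectation N H hH x) =
      expectation N (K ⊓ D) hKD x - expectation N H hH x
    rw [map_sub, map_sub, expectation_expectation hK hD hKD,
      expectation_fix hK (crossedSub_mono h (expectation_mem hH x)),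
      expectation_expectation_of_le hH hD h', hHH, sub_self, sub_zero]
  rw [innerA, adjointOf_expectation_sub hH hK h, hmul, map_sub,
    dualExpectation_expectation hH hKD (le_inf h h'), dualExpectation_expectation hH hH le_rfl,
    Subgroup.relIndex_self, ← sub_smul, Nat.cast_one, mul_sub]

theorem norm_innerA_expectation_sub [Nontrivial N.Compl]
    (hKD : ∀ x, N (Cc.restrict α (K ⊓ D) x) ≤ N x) (h : H ≤ K) (h' : H ≤ D) :
    ‖innerA (expectationₗ H hH) (expectationₗ K hK - expectationₗ H hH)
      (expectationₗ D hD - expectationₗ H hH)‖ =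
      (H.index : ℝ)⁻¹ * ((H.relIndex (K ⊓ D) : ℝ) - 1) := by
  have h1 : (1 : ℝ) ≤ H.relIndex (K ⊓ D) := by
    exact_mod_cast Nat.pos_of_ne_zero (relIndex_ne_zero_of_finiteIndex H (K ⊓ D))
  rw [innerA_expectation_sub hH hK hD hKD h h', norm_smul, CStarRing.norm_one, mul_one, norm_mul,
    norm_inv, Complex.norm_natCast]
  congr 1
  have : ((H.relIndex (K ⊓ D) : ℂ) - 1) = (((H.relIndex (K ⊓ D) : ℝ) - 1 : ℝ) : ℂ) := by
    push_cast; rfl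
  rw [this, Complex.norm_real, Real.norm_of_nonneg (by linarith)]

theorem interiorAngle_eq_zero_iff [Nontrivial N.Compl]
    (hN : ∀ L, H ≤ L → ∀ x, N (Cc.restrict α L x) ≤ N x) (h : H < K) (h' : H ≤ D)
    (hKD : H.relIndex D = H.relIndex K) :
    interiorAngle (expectationₗ H (hN H le_rfl)) (crossedSub N K) (crossedSub N D) = 0 ↔
      H.relIndex K ≤ H.relIndex (K ⊓ D) := by
  -- Properness of H < K makes the denominator [K:H] − 1 of the cosine positive.
  have hr : (1 : ℝ) < H.relIndex K := by
    have h0 : H.relIndex K ≠ 0 := relIndex_ne_zero_of_finiteIndex _ _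
    have h1 : H.relIndex K ≠ 1 := fun h1 => h.not_ge (Subgroup.relIndex_eq_one.1 h1)
    exact_mod_cast (by omega : 1 < H.relIndex K)
  have hn : (0 : ℝ) < H.index :=
    Nat.cast_pos.2 (Nat.pos_of_ne_zero Subgroup.FiniteIndex.index_ne_zero)
  -- `Real.arccos` vanishes exactly on [1, ∞), so the condition is an inequality. By `hKD` the two
  -- norms in the denominator agree, and their product is [G:H]⁻¹([K:H] − 1).
  rw [interiorAngle, Real.arccos_eq_zero, jones_expectation _ (hN K h.le) h.le,
    jones_expectation _ (hN D h') h', normA1, normA1,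
    norm_innerA_expectation_sub _ _ _ (hN _ (le_inf h.le h')) h.le h',
    norm_innerA_expectation_sub _ _ _ (hN _ (le_inf h.le h.le)) h.le h.le,
    norm_innerA_expectation_sub _ _ _ (hN _ (le_inf h' h')) h' h', inf_idem, inf_idem, hKD,
    Real.mul_self_sqrt (by have := inv_pos.2 hn; nlinarith), mul_div_mul_left _ _ (by positivity),
    one_le_div (by linarith), sub_le_sub_iff_right, Nat.cast_le]

include hK in
theorem crossedSub_mem_IMS_diff [Nontrivial N.Compl] (h : H < K) :
    crossedSub N K ∈ IMS (crossedSub N H) (expectationₗ H hH) \ {crossedSub N H} := by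
  refine ⟨⟨isClosed_crossedSub K, crossedSub_mono h.le, _,
    isCompatible_expectation hH hK h.le⟩, fun heq => ?_⟩
  obtain ⟨k, hk, hkH⟩ := SetLike.exists_of_lt h
  have h1 : N.ι (Cc.unitary α k) ∈ crossedSub N H := by
    rw [← Set.mem_singleton_iff.1 heq]
    exact unitary_mem_crossedSub hk
  have h2 := expectation_fix hH h1
  -- For k in K outside H, E both fixes and kills u_k; a vanishing unitary contradicts 1 ≠ 0.
  rw [expectation_ι, Cc.unitary, Cc.restrict_single_notMem α hkH, map_zero] at h2
  have h3 := ι_unitary_mul_star (N := N) k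
  rw [Cc.unitary, ← h2, zero_mul] at h3
  exact zero_ne_one h3

/-- The conclusion on interior angles, for any C*-norm on `C_c(G, P)` for which restriction to
the intermediate subgroups is contractive. -/
theorem angle_theorem_of_contractive (h1 : N 1 ≠ 0)
    (hN : ∀ L, H ≤ L → ∀ x, N (Cc.restrict α L x) ≤ N x) (h : H < K)
    {g : G} (hg : g ∈ Subgroup.normalizer (H : Set G)) :
    (∃ E, IsCanonicalExpectation N H E) ∧
      ∀ E, IsCanonicalExpectation N H E →
        HasFiniteIndex E ∧
        crossedSub N K ∈ IMS (crossedSub N H) E \ {crossedSub N H} ∧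
        crossedSub N (conjSubgroup g K) ∈ IMS (crossedSub N H) E \ {crossedSub N H} ∧
        (interiorAngle E (crossedSub N K) (crossedSub N (conjSubgroup g K)) = 0 ↔
          g ∈ Subgroup.normalizer (K : Set G)) := by
  have : Nontrivial N.Compl := by
    refine ⟨N.ι 1, 0, fun h0 => h1 ?_⟩
    rw [← N.norm_ι, h0, norm_zero]
  have hD : H < conjSubgroup g K := by
    have := (Subgroup.map_lt_map_iff_of_injective
      (f := (MulAut.conj g⁻¹).toMonoidHom) (MulAut.conj g⁻¹).injective).2 h
    conv_lhs => rw [← conjSubgroup_eq_self_iff.2 hg]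
    exact this
  refine ⟨⟨_, isCanonicalExpectation_expectation (hN H le_rfl)⟩, fun E hE => ?_⟩
  rw [hE.eq_expectation (hN H le_rfl)]
  refine ⟨hasFiniteIndex_expectation _, crossedSub_mem_IMS_diff _ (hN K h.le) h,
    crossedSub_mem_IMS_diff _ (hN _ hD.le) hD, ?_⟩
  rw [interiorAngle_eq_zero_iff hN h hD.le (relIndex_conjSubgroup K hg),
    relIndex_le_relIndex_inf_conjSubgroup_iff h.le hg]

end AngleFormula

/-! ### Matrices of operators -/

noncomputable section OperatorMatrices

variable {ι : Type*} [Fintype ι] {ℋ : Type*} [NormedAddCommGroup ℋ] [InnerProductSpace ℂ ℋ]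

/-- The operator on `ℋ^ι` given by a matrix of operators on `ℋ`. -/
def matrixOp (M : ι → ι → ℋ →L[ℂ] ℋ) :
    PiLp 2 (fun _ : ι => ℋ) →L[ℂ] PiLp 2 (fun _ : ι => ℋ) :=
  ((PiLp.continuousLinearEquiv 2 ℂ fun _ : ι => ℋ).symm : (ι → ℋ) →L[ℂ] _) ∘L
    (ContinuousLinearMap.pi fun i => ∑ j, M i j ∘L ContinuousLinearMap.proj j) ∘L
    ((PiLp.continuousLinearEquiv 2 ℂ fun _ : ι => ℋ) : _ →L[ℂ] (ι → ℋ))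

theorem matrixOp_apply (M : ι → ι → ℋ →L[ℂ] ℋ) (ξ : PiLp 2 (fun _ : ι => ℋ)) (i : ι) :
    matrixOp M ξ i = ∑ j, M i j (ξ j) := by
  change (∑ j, M i j ∘L ContinuousLinearMap.proj j) (fun k => ξ k) = _
  rw [sum_apply]
  rfl

theorem matrixOp_single [DecidableEq ι] (M : ι → ι → ℋ →L[ℂ] ℋ) (i j : ι) (v : ℋ) :
    matrixOp M (PiLp.single 2 j v) i = M i j v := by
  rw [matrixOp_apply, Finset.sum_eq_single j]
  · simp
  · intro k _ hk
    simp [hk]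
  · simp

theorem norm_entry_le_norm_matrixOp (M : ι → ι → ℋ →L[ℂ] ℋ) (i j : ι) :
    ‖M i j‖ ≤ ‖matrixOp M‖ := by
  classical
  refine ContinuousLinearMap.opNorm_le_bound _ (norm_nonneg (matrixOp M)) fun v => ?_
  rw [← matrixOp_single M]
  refine (PiLp.norm_apply_le _ _).trans (((matrixOp M).le_opNorm _).trans_eq ?_)
  rw [PiLp.norm_single]

variable [CompleteSpace ℋ]

variable (ι ℋ) in
/-- `M_ι(B(ℋ))` acting on `ℋ^ι`, as a `*`-homomorphism. -/
def matrixOpHom : CStarMatrix ι ι (ℋ →L[ℂ] ℋ) →⋆ₙₐ[ℂ]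
    (PiLp 2 (fun _ : ι => ℋ) →L[ℂ] PiLp 2 (fun _ : ι => ℋ)) where
  toFun M := matrixOp fun i j => M i j
  map_smul' c M := by
    ext ξ i
    simp [matrixOp_apply, Finset.smul_sum]
  map_zero' := by
    ext ξ i
    simp [matrixOp_apply]
  map_add' M M' := by
    ext ξ i
    simp [matrixOp_apply, Finset.sum_add_distrib]
  map_mul' M M' := by
    ext ξ i
    simp only [matrixOp_apply, mul_apply_eq_comp, CStarMatrix.mul_apply,
      sum_apply, map_sum]
    exact Finset.sum_comm
  map_star' M := by
    rw [ContinuousLinearMap.star_eq_adjoint, ContinuousLinearMap.eq_adjoint_iff]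
    intro ξ η
    simp only [PiLp.inner_apply, matrixOp_apply, sum_inner, inner_sum, CStarMatrix.star_apply,
      ContinuousLinearMap.star_eq_adjoint, ContinuousLinearMap.adjoint_inner_left]
    exact Finset.sum_comm

theorem matrixOpHom_injective : Function.Injective (matrixOpHom ι ℋ) := by
  classical
  intro M M' h
  ext i j v
  rw [← matrixOp_single (fun i j => M i j), ← matrixOp_single (fun i j => M' i j)]
  exact congrArg (fun T : PiLp 2 (fun _ : ι => ℋ) →L[ℂ] PiLp 2 (fun _ : ι => ℋ) =>
    T (PiLp.single 2 j v) i) h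

/-- The norm of an operator matrix with entries in a C*-algebra `P` is dominated by the norm in
any faithful representation of `P`. -/
theorem norm_matrixOp_le_of_injective {P : Type*} [CStarAlgebra P]
    {𝒦 : Type*} [NormedAddCommGroup 𝒦] [InnerProductSpace ℂ 𝒦] [CompleteSpace 𝒦]
    (φ : P →⋆ₐ[ℂ] (ℋ →L[ℂ] ℋ)) (hφ : Function.Injective φ) (ψ : P →⋆ₐ[ℂ] (𝒦 →L[ℂ] 𝒦))
    (M : ι → ι → P) :
    ‖matrixOp fun i j => ψ (M i j)‖ ≤ ‖matrixOp fun i j => φ (M i j)‖ := by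
  let _ := CStarAlgebra.spectralOrder P
  have _ := CStarAlgebra.spectralOrderedRing P
  let Φ : CStarMatrix ι ι P →⋆ₙₐ[ℂ] (PiLp 2 (fun _ : ι => ℋ) →L[ℂ] PiLp 2 (fun _ : ι => ℋ)) :=
    (matrixOpHom ι ℋ).comp (CStarMatrix.mapₙₐ φ.toNonUnitalStarAlgHom)
  let Ψ : CStarMatrix ι ι P →⋆ₙₐ[ℂ] (PiLp 2 (fun _ : ι => 𝒦) →L[ℂ] PiLp 2 (fun _ : ι => 𝒦)) :=
    (matrixOpHom ι 𝒦).comp (CStarMatrix.mapₙₐ ψ.toNonUnitalStarAlgHom)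
  have hΦ : Function.Injective Φ := by
    refine matrixOpHom_injective.comp fun M M' h => ?_
    ext i j
    exact hφ (congrFun (congrFun h i) j)
  -- Every `*`-homomorphism of C*-algebras is contractive and an injective one is isometric; both
  -- are applied to the matrix algebra over P.
  exact (NonUnitalStarAlgHom.norm_apply_le Ψ (CStarMatrix.ofMatrix M)).trans
    (NonUnitalStarAlgHom.norm_map Φ hΦ (CStarMatrix.ofMatrix M)).ge

end OperatorMatrices

/-! ### Norms in ℓ²(X, ℋ) -/

noncomputable section SquareSummable

variable {X : Type*} {ℋ : Type*} [NormedAddCommGroup ℋ]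

theorem lp_hasSum_norm_sq (ξ : lp (fun _ : X => ℋ) 2) :
    HasSum (fun t => ‖ξ t‖ ^ 2) (‖ξ‖ ^ 2) := by
  have := lp.hasSum_norm (p := 2) (by norm_num) ξ
  simpa using this

theorem lp_sum_norm_sq_le (ξ : lp (fun _ : X => ℋ) 2) (s : Finset X) :
    ∑ t ∈ s, ‖ξ t‖ ^ 2 ≤ ‖ξ‖ ^ 2 :=
  sum_le_hasSum s (fun _ _ => by positivity) (lp_hasSum_norm_sq ξ)

theorem lp_norm_le_of_forall_sum_sq_le {ξ : lp (fun _ : X => ℋ) 2} {C : ℝ} (hC : 0 ≤ C)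
    (h : ∀ s : Finset X, ∑ t ∈ s, ‖ξ t‖ ^ 2 ≤ C ^ 2) : ‖ξ‖ ≤ C :=
  lp.norm_le_of_forall_sum_le (p := 2) (by norm_num) hC fun s => by simpa using h s

theorem lp_norm_sum_single_sq [DecidableEq X] {ι : Type*} [Fintype ι] {e : ι → X}
    (he : Function.Injective e) (η : ι → ℋ) :
    ‖∑ i, lp.single (E := fun _ : X => ℋ) 2 (e i) (η i)‖ ^ 2 = ∑ i, ‖η i‖ ^ 2 := by
  have := lp.norm_sum_single (E := fun _ : X => ℋ) (p := 2) (by norm_num)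
    (Function.extend e η 0) (Finset.univ.map ⟨e, he⟩)
  simpa [Finset.sum_map, he.extend_apply] using this

end SquareSummable

/-! ### Reduced norm: isometric inclusions and contractive restriction -/

noncomputable section ReducedNorms

namespace Cc

variable {P : Type u} [CStarAlgebra P] {G : Type v} [Group G] (α : G →* (P ≃⋆ₐ[ℂ] P))
variable {ℋ : Type w} [NormedAddCommGroup ℋ] [InnerProductSpace ℂ ℋ] [CompleteSpace ℋ]

theorem regular_single (φ : P →⋆ₐ[ℂ] (ℋ →L[ℂ] ℋ)) (s : G) (a : P) :
    regular α φ (single α s a) = op α φ s a := regularHom_single α φ s a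

theorem hasSum_regular (φ : P →⋆ₐ[ℂ] (ℋ →L[ℂ] ℋ)) (y : Cc α) (ξ : lp (fun _ : G => ℋ) 2)
    (t : G) :
    HasSum (fun s => φ (α t⁻¹ (coeff α y (t * s⁻¹))) (ξ s)) (regular α φ y ξ t) := by
  induction y using induction_on with
  | h0 => simp [coeff_zero, hasSum_zero]
  | hadd x y hx hy => simpa [coeff_add] using hx.add hy
  | hs r a =>
    rw [regular_single, op_apply]
    have h := hasSum_single (f := fun s => φ (α t⁻¹ (coeff α (single α r a) (t * s⁻¹))) (ξ s))
      (r⁻¹ * t) fun s hs => by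
        have : t * s⁻¹ ≠ r := by
          rintro rfl
          exact hs (by group)
        simp [coeff_single_of_ne α this]
    have h' : t * (r⁻¹ * t)⁻¹ = r := by group
    rwa [h', coeff_single_self] at h

theorem regular_lp_single [DecidableEq G] (φ : P →⋆ₐ[ℂ] (ℋ →L[ℂ] ℋ)) (y : Cc α) (s t : G)
    (v : ℋ) :
    regular α φ y (lp.single (E := fun _ : G => ℋ) 2 s v) t =
      φ (α t⁻¹ (coeff α y (t * s⁻¹))) v := by
  refine (hasSum_regular α φ y _ t).unique ?_
  have := hasSum_single (f := fun r => φ (α t⁻¹ (coeff α y (t * r⁻¹)))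
    (lp.single (E := fun _ : G => ℋ) 2 s v r)) s fun r hr => by
      rw [lp.single_apply_ne _ _ _ hr, map_zero]
  rwa [lp.single_apply_self] at this

/-- The compression of the regular representation to finitely many coordinates, as a matrix with
entries in `P`. -/
def compressionMatrix {ι : Type*} (e : ι → G) (y : Cc α) (i j : ι) : P :=
  α (e i)⁻¹ (coeff α y (e i * (e j)⁻¹))

theorem norm_compression_le (φ : P →⋆ₐ[ℂ] (ℋ →L[ℂ] ℋ)) {ι : Type*} [Fintype ι] {e : ι → G}
    (he : Function.Injective e) (y : Cc α) :
    ‖matrixOp fun i j => φ (compressionMatrix α e y i j)‖ ≤ ‖regular α φ y‖ := by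
  classical
  refine ContinuousLinearMap.opNorm_le_bound _ (norm_nonneg _) fun η => ?_
  refine le_of_sq_le_sq ?_ (by positivity)
  set ξ : lp (fun _ : G => ℋ) 2 := ∑ i, lp.single (E := fun _ : G => ℋ) 2 (e i) (η i) with hξ
  have h1 : ‖ξ‖ = ‖η‖ := by
    rw [← sq_eq_sq₀ (norm_nonneg _) (norm_nonneg _), hξ, lp_norm_sum_single_sq he,
      PiLp.norm_sq_eq_of_L2]
  have h2 : ∀ i, matrixOp (fun i j => φ (compressionMatrix α e y i j)) η i =
      regular α φ y ξ (e i) := fun i => by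
    rw [matrixOp_apply, hξ, map_sum, lp.coeFn_sum, Finset.sum_apply]
    exact Finset.sum_congr rfl fun j _ => (regular_lp_single α φ y (e j) (e i) (η j)).symm
  rw [PiLp.norm_sq_eq_of_L2, ← h1]
  simp only [h2]
  have h3 := lp_sum_norm_sq_le (regular α φ y ξ) (Finset.univ.map ⟨e, he⟩)
  rw [Finset.sum_map] at h3
  refine h3.trans ?_
  gcongr
  exact (regular α φ y).le_opNorm ξ

/-- With `norm_compression_le`, this makes the regular norm the supremum of its finite compressions.
These are matrices over P, whose norms do not depend on the faithful representation. -/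
theorem norm_regular_le_of_compression (φ : P →⋆ₐ[ℂ] (ℋ →L[ℂ] ℋ)) (y : Cc α) {C : ℝ}
    (hC : 0 ≤ C) (h : ∀ F : Finset G,
      ‖matrixOp fun i j => φ (compressionMatrix α ((↑) : F → G) y i j)‖ ≤ C) :
    ‖regular α φ y‖ ≤ C := by
  refine ContinuousLinearMap.opNorm_le_bound _ hC fun ξ => ?_
  refine lp_norm_le_of_forall_sum_sq_le (by positivity) fun S => ?_
  have hlim : Filter.Tendsto (fun F : Finset G => ∑ t ∈ S,
      ‖∑ s ∈ F, φ (α t⁻¹ (coeff α y (t * s⁻¹))) (ξ s)‖ ^ 2) Filter.atTop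
      (nhds (∑ t ∈ S, ‖regular α φ y ξ t‖ ^ 2)) :=
    tendsto_finsetSum _ fun t _ => ((hasSum_regular α φ y ξ t).norm.pow 2)
  -- Once F contains S, the truncated sum is bounded by the norm of the square compression to F.
  refine le_of_tendsto hlim (Filter.eventually_atTop.2 ⟨S, fun F hF => ?_⟩)
  let η : PiLp 2 (fun _ : F => ℋ) := WithLp.toLp 2 fun s => ξ s
  have h1 : ‖η‖ ^ 2 ≤ ‖ξ‖ ^ 2 := by
    rw [PiLp.norm_sq_eq_of_L2]
    exact (Finset.sum_coe_sort F fun s => ‖ξ s‖ ^ 2).trans_le (lp_sum_norm_sq_le ξ F)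
  have h2 := ((matrixOp fun i j => φ (compressionMatrix α ((↑) : F → G) y i j)).le_opNorm η).trans
    (mul_le_mul_of_nonneg_right (h F) (norm_nonneg _))
  calc _ ≤ ∑ t ∈ F, ‖∑ s ∈ F, φ (α t⁻¹ (coeff α y (t * s⁻¹))) (ξ s)‖ ^ 2 :=
        Finset.sum_le_sum_of_subset_of_nonneg hF fun _ _ _ => by positivity
    _ = ‖matrixOp (fun i j => φ (compressionMatrix α ((↑) : F → G) y i j)) η‖ ^ 2 := by
        rw [PiLp.norm_sq_eq_of_L2, ← Finset.sum_coe_sort F]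
        refine Finset.sum_congr rfl fun t _ => ?_
        rw [matrixOp_apply, ← Finset.sum_coe_sort F]
        rfl
    _ ≤ (C * ‖η‖) ^ 2 := by gcongr
    _ ≤ (C * ‖ξ‖) ^ 2 := by
        rw [mul_pow, mul_pow]
        gcongr

/-- The reduced norm is dominated by the one computed from a faithful representation. -/
theorem norm_regular_le_of_injective {𝒦 : Type*} [NormedAddCommGroup 𝒦] [InnerProductSpace ℂ 𝒦]
    [CompleteSpace 𝒦] (φ : P →⋆ₐ[ℂ] (ℋ →L[ℂ] ℋ)) (hφ : Function.Injective φ)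
    (ψ : P →⋆ₐ[ℂ] (𝒦 →L[ℂ] 𝒦)) (y : Cc α) : ‖regular α ψ y‖ ≤ ‖regular α φ y‖ :=
  norm_regular_le_of_compression α ψ y (norm_nonneg _) fun _ =>
    (norm_matrixOp_le_of_injective φ hφ ψ _).trans
      (norm_compression_le α φ Subtype.val_injective y)

/-- For points of L the quotients e_i e_j⁻¹ stay in L, so a compression of the restricted element is
literally a compression of x. -/
theorem norm_regular_resHom_le (φ : P →⋆ₐ[ℂ] (ℋ →L[ℂ] ℋ)) (L : Subgroup G) (x : Cc α) :
    ‖regular (res α L) φ (resHom α L x)‖ ≤ ‖regular α φ x‖ :=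
  norm_regular_le_of_compression _ φ _ (norm_nonneg _) fun F =>
    norm_compression_le α φ (e := fun i : F => ((i : L) : G))
      (Subtype.val_injective.comp Subtype.val_injective) x

omit [InnerProductSpace ℂ ℋ] [CompleteSpace ℋ] in
theorem memℓp_cosetPart (L : Subgroup G) (r : G) (ξ : lp (fun _ : G => ℋ) 2) :
    Memℓp (fun t : L => ξ (t * r)) 2 := by
  have h := lp.memℓp ξ
  rw [memℓp_gen_iff (by norm_num)] at h ⊢
  exact h.comp_injective ((mul_left_injective r).comp Subtype.val_injective)

/-- The restriction of a vector in `ℓ²(G, ℋ)` to the right coset of `L` represented by `r`. -/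
def cosetPart (L : Subgroup G) (r : G) (ξ : lp (fun _ : G => ℋ) 2) : lp (fun _ : L => ℋ) 2 :=
  ⟨fun t => ξ (t * r), memℓp_cosetPart L r ξ⟩

omit [InnerProductSpace ℂ ℋ] [CompleteSpace ℋ] in
theorem cosetPart_apply (L : Subgroup G) (r : G) (ξ : lp (fun _ : G => ℋ) 2) (t : L) :
    cosetPart L r ξ t = ξ (t * r) := rfl

/-- Elements of L preserve the right coset Lr. Identifying it with L by t ↦ tr twists φ, since
α_{(tr)⁻¹} = α_{r⁻¹} α_{t⁻¹}. -/
theorem cosetPart_regular_incl (φ : P →⋆ₐ[ℂ] (ℋ →L[ℂ] ℋ)) (L : Subgroup G) (r : G)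
    (y : Cc (res α L)) (ξ : lp (fun _ : G => ℋ) 2) :
    cosetPart L r (regular α φ (incl α L y) ξ) =
      regular (res α L) (φ.comp (α r⁻¹ : P →⋆ₐ[ℂ] P)) y (cosetPart L r ξ) := by
  ext t
  rw [cosetPart_apply]
  induction y using induction_on with
  | h0 => simp
  | hadd x y hx hy => simp [hx, hy]
  | hs s a =>
    rw [incl_single, regular_single, regular_single, op_apply, op_apply, cosetPart_apply,
      mul_inv_rev, map_mul, StarAlgEquiv.mul_apply, ← mul_assoc]
    rfl

/-- A group is the disjoint union of the right cosets of a subgroup. -/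
def rightCosetEquiv (L : Subgroup G) : (G ⧸ L) × L ≃ G where
  toFun p := (p.2 : G) * p.1.out⁻¹
  -- `G ⧸ L` consists of left cosets; inversion converts them into right cosets.
  invFun g := (QuotientGroup.mk g⁻¹, ⟨g * (QuotientGroup.mk g⁻¹ : G ⧸ L).out, by
    have := QuotientGroup.eq.1 (QuotientGroup.out_eq' (QuotientGroup.mk g⁻¹ : G ⧸ L)).symm
    simpa using this⟩)
  left_inv p := by
    have h : (QuotientGroup.mk ((p.2 : G) * p.1.out⁻¹)⁻¹ : G ⧸ L) = p.1 := by
      conv_rhs => rw [← QuotientGroup.out_eq' p.1]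
      rw [QuotientGroup.eq]
      simp
    refine Prod.ext h (Subtype.ext ?_)
    simp only [h]
    simp
  right_inv g := by simp

omit [InnerProductSpace ℂ ℋ] [CompleteSpace ℋ] in
theorem hasSum_cosetPart (L : Subgroup G) (ξ : lp (fun _ : G => ℋ) 2) :
    HasSum (fun q : G ⧸ L => ‖cosetPart L q.out⁻¹ ξ‖ ^ 2) (‖ξ‖ ^ 2) := by
  have h : HasSum (fun p : (G ⧸ L) × L => ‖ξ (p.2 * p.1.out⁻¹)‖ ^ 2) (‖ξ‖ ^ 2) :=
    (Equiv.hasSum_iff (f := fun g => ‖ξ g‖ ^ 2) (rightCosetEquiv L)).2 (lp_hasSum_norm_sq ξ)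
  have h' : ∀ q : G ⧸ L, HasSum (fun l : L => ‖ξ (l * q.out⁻¹)‖ ^ 2)
      (‖cosetPart L q.out⁻¹ ξ‖ ^ 2) := fun q => lp_hasSum_norm_sq (cosetPart L q.out⁻¹ ξ)
  exact HasSum.prod_fiberwise h h'

/-- On each right coset the operator is a regular representation of L built from a twist of φ, and
its norm is at most the one for the faithful φ; the squared norms then add up over cosets. -/
theorem norm_regular_incl_le (φ : P →⋆ₐ[ℂ] (ℋ →L[ℂ] ℋ)) (hφ : Function.Injective φ)
    (L : Subgroup G) (y : Cc (res α L)) :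
    ‖regular α φ (incl α L y)‖ ≤ ‖regular (res α L) φ y‖ := by
  refine ContinuousLinearMap.opNorm_le_bound _ (norm_nonneg _) fun ξ => ?_
  refine le_of_sq_le_sq ?_ (by positivity)
  rw [mul_pow]
  refine hasSum_le (fun q => ?_) (hasSum_cosetPart L _) ((hasSum_cosetPart L ξ).mul_left _)
  rw [cosetPart_regular_incl, ← mul_pow]
  gcongr
  refine (ContinuousLinearMap.le_opNorm _ _).trans ?_
  gcongr
  exact norm_regular_le_of_injective _ φ hφ _ y

theorem reducedNorm_incl (φ : P →⋆ₐ[ℂ] (ℋ →L[ℂ] ℋ)) (hφ : Function.Injective φ)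
    (L : Subgroup G) (y : Cc (res α L)) :
    reducedNorm α φ (incl α L y) = reducedNorm (res α L) φ y := by
  refine le_antisymm (norm_regular_incl_le α φ hφ L y) ?_
  have := norm_regular_resHom_le α φ L (incl α L y)
  rwa [resHom_incl] at this

theorem reducedNorm_restrict_le (φ : P →⋆ₐ[ℂ] (ℋ →L[ℂ] ℋ)) (hφ : Function.Injective φ)
    (L : Subgroup G) (x : Cc α) : reducedNorm α φ (restrict α L x) ≤ reducedNorm α φ x := by
  rw [← incl_resHom, reducedNorm_incl α φ hφ]
  exact norm_regular_resHom_le α φ L x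

theorem reducedNorm_one [Nontrivial P] (φ : P →⋆ₐ[ℂ] (ℋ →L[ℂ] ℋ)) [Nontrivial ℋ] :
    reducedNorm α φ 1 = 1 := by
  classical
  have : Nontrivial (lp (fun _ : G => ℋ) 2) := by
    obtain ⟨v, hv⟩ := exists_ne (0 : ℋ)
    refine ⟨lp.single (E := fun _ : G => ℋ) 2 1 v, 0, fun h => hv ?_⟩
    rw [← lp.single_apply_self (E := fun _ : G => ℋ) 2 1 v, h]
    rfl
  change ‖regular α φ 1‖ = 1
  rw [map_one, norm_one]

end Cc

end ReducedNorms

/-! ### Existence of states and representations -/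

noncomputable section States

open scoped ComplexOrder

variable (P : Type u) [CStarAlgebra P] [Nontrivial P]

/-- A nonzero unital C*-algebra has a state. -/
theorem exists_state [PartialOrder P] [StarOrderedRing P] : ∃ f : P →ₚ[ℂ] ℂ, f 1 = 1 := by
  obtain ⟨g, hg, hg1⟩ := exists_dual_vector ℂ (1 : P) (by simp)
  rw [norm_one] at hg1
  -- A norm-one functional with g(1) = 1 has nonnegative real part on a ≥ 0: |‖a‖ − g(a)| ≤ ‖‖a‖·1 −
  -- a‖ ≤ ‖a‖.
  have hre : ∀ a : P, 0 ≤ a → 0 ≤ (g a).re := fun a ha => by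
    have h1 : ‖algebraMap ℝ P ‖a‖ - a‖ ≤ ‖a‖ := by
      have h2 : a ≤ algebraMap ℝ P ‖a‖ := IsSelfAdjoint.le_algebraMap_norm_self (.of_nonneg ha)
      have h3 := CStarAlgebra.norm_le_norm_of_nonneg_of_le (sub_nonneg.2 h2) (sub_le_self _ ha)
      rwa [norm_algebraMap', norm_norm] at h3
    have h2 := (g.le_opNorm (algebraMap ℝ P ‖a‖ - a)).trans_eq (by rw [hg, one_mul])
    have h3 : g (algebraMap ℝ P ‖a‖ - a) = (‖a‖ : ℂ) - g a := by
      rw [map_sub, IsScalarTower.algebraMap_apply ℝ ℂ P, Algebra.algebraMap_eq_smul_one, map_smul,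
        hg1]
      simp
    rw [h3] at h2
    have h4 := (Complex.abs_re_le_norm _).trans (h2.trans h1)
    rw [Complex.sub_re, Complex.ofReal_re] at h4
    linarith [(abs_le.1 h4).2]
  -- The Hermitian part of g, which equals Re g on self-adjoint elements; this avoids showing that g
  -- itself is real there.
  let f : P →ₗ[ℂ] ℂ :=
    { toFun := fun a => (1 / 2 : ℂ) * (g a + star (g (star a)))
      map_add' := fun a b => by simp only [star_add, map_add]; ring
      map_smul' := fun c a => by
        simp only [star_smul, map_smul, smul_eq_mul, RingHom.id_apply, star_mul, star_star]
        ring }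
  refine ⟨PositiveLinearMap.mk₀ f fun a ha => ?_, ?_⟩
  · have h : f a = ((g a).re : ℂ) := by
      change (1 / 2 : ℂ) * (g a + star (g (star a))) = _
      rw [(IsSelfAdjoint.of_nonneg ha).star_eq, Complex.star_def, Complex.add_conj]
      push_cast
      ring
    rw [h]
    exact_mod_cast hre a ha
  · change (1 / 2 : ℂ) * (g 1 + star (g (star 1))) = 1
    rw [star_one, hg1]
    norm_num

/-- A nonzero unital C*-algebra has a unital representation on a nonzero Hilbert space. -/
theorem exists_representation : ∃ (ℋ : Type u) (_ : NormedAddCommGroup ℋ)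
    (_ : InnerProductSpace ℂ ℋ) (_ : CompleteSpace ℋ) (_ : P →⋆ₐ[ℂ] (ℋ →L[ℂ] ℋ)),
    Nontrivial ℋ := by
  let _ := CStarAlgebra.spectralOrder P
  have _ := CStarAlgebra.spectralOrderedRing P
  obtain ⟨f, hf⟩ := exists_state P
  refine ⟨f.GNS, inferInstance, inferInstance, inferInstance, f.gnsStarAlgHom,
    ((f.toPreGNS 1 : f.PreGNS) : f.GNS), 0, fun h => ?_⟩
  have h1 : ‖((f.toPreGNS 1 : f.PreGNS) : f.GNS)‖ ^ 2 = 0 := by rw [h]; simp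
  have h2 := f.preGNS_norm_sq (f.toPreGNS 1)
  rw [UniformSpace.Completion.norm_coe] at h1
  simp only [PositiveLinearMap.ofPreGNS_toPreGNS, star_one, mul_one, hf] at h2
  rw [← Complex.ofReal_pow, h1] at h2
  simp at h2

end States

/-! ### Universal norm: induced representations -/

noncomputable section UniversalNorms

namespace Cc

variable {P : Type u} [CStarAlgebra P] {G : Type v} [Group G] (α : G →* (P ≃⋆ₐ[ℂ] P))

/-- The supremum also ranges over degenerate representations, such as 0, so one with π(1) ≠ 0 must
be exhibited: the regular representation of a GNS representation of P. -/
theorem universalNorm_one_ne_zero [Nontrivial P] : universalNorm α 1 ≠ 0 := by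
  obtain ⟨ℋ, _, _, _, φ, _⟩ := exists_representation P
  have h := le_universal α (regular α φ).toNonUnitalStarAlgHom 1
  have h1 : ‖(regular α φ).toNonUnitalStarAlgHom (1 : Cc α)‖ = 1 := reducedNorm_one α φ
  rw [h1] at h
  exact (one_pos.trans_le h).ne'

variable {ℋ : Type*} [NormedAddCommGroup ℋ] [InnerProductSpace ℂ ℋ] [CompleteSpace ℋ]

/-- The representation of `C_c(G, P)` induced from a representation of `C_c(L, P)`, for a
subgroup `L` of finite index. -/
def inducedRep {L : Subgroup G} [Fintype ((⊤ : Subgroup G) ⧸ L.subgroupOf ⊤)]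
    (π : Cc (res α L) →⋆ₙₐ[ℂ] (ℋ →L[ℂ] ℋ)) :
    Cc α →⋆ₙₐ[ℂ] CStarMatrix ((⊤ : Subgroup G) ⧸ L.subgroupOf ⊤)
      ((⊤ : Subgroup G) ⧸ L.subgroupOf ⊤) (ℋ →L[ℂ] ℋ) where
  toFun x := CStarMatrix.ofMatrix fun i j =>
    π (resHom α L (star (unitary α (i.out : G)) * x * unitary α (j.out : G)))
  map_smul' c x := by
    ext1 i j
    simp only [mul_smul_comm, smul_mul_assoc, map_smul]
    rfl
  map_zero' := by
    ext1 i j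
    simp only [mul_zero, zero_mul, map_zero]
    rfl
  map_add' x y := by
    ext1 i j
    simp only [mul_add, add_mul, map_add]
    rfl
  map_mul' x y := by
    ext1 i k
    rw [CStarMatrix.mul_apply]
    change π _ = ∑ j, π _ * π _
    simp only [← map_mul, ← map_sum]
    congr 1
    simp only [← resHom_mul_incl, incl_resHom, ← map_sum]
    congr 1
    simp only [mul_assoc, ← Finset.mul_sum]
    -- Multiplicativity amounts to inserting the coset expansion of u_k-translated y, the case K =
    -- G, between the two factors.
    rw [← restrict_eq_sum α le_top, restrict_top]
  map_star' x := by
    ext1 i j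
    rw [CStarMatrix.star_apply]
    change π _ = star (π _)
    rw [← map_star, star_resHom, star_mul, star_mul, star_star, mul_assoc]

theorem universalNorm_unitary_le_one (s : G) : universalNorm α (unitary α s) ≤ 1 := by
  have h1 := (universalNorm α).star_mul_self' 1
  -- The C*-identity gives N(1) = N(1)², so N(1) is 0 or 1, and N(u)² = N(1).
  have h2 := (universalNorm α).star_mul_self' (unitary α s)
  rw [star_unitary, unitary_mul, inv_mul_cancel, unitary_one] at h2
  rw [star_one, one_mul] at h1
  have h3 := (universalNorm α).nonneg 1
  have h4 := (universalNorm α).nonneg (unitary α s)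
  have h5 : universalNorm α 1 ≤ 1 := by
    rcases h3.eq_or_lt with h | h
    · exact h.symm.trans_le zero_le_one
    · exact (mul_left_cancel₀ h.ne' ((mul_one _).trans h1)).ge
  exact abs_le_of_sq_le_sq' (by nlinarith) zero_le_one |>.2

theorem universalNorm_resHom_le {L : Subgroup G} [L.FiniteIndex] (x : Cc α) :
    universalNorm (res α L) (resHom α L x) ≤ universalNorm α x := by
  have : Fintype ((⊤ : Subgroup G) ⧸ L.subgroupOf ⊤) := Fintype.ofFinite _
  refine universal_le _ fun ℋ _ _ _ π => ?_
  -- The restriction of x should be the diagonal entry at the trivial coset, but its chosen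
  -- representative need not be 1; conjugating x by u compensates, at no cost in norm.
  let i : (⊤ : Subgroup G) ⧸ L.subgroupOf ⊤ := QuotientGroup.mk 1
  let u : Cc α := unitary α (i.out : G)
  have hu : star u * (u * x * star u) * u = x := by
    have h : star u * u = 1 := by
      rw [star_unitary, unitary_mul, inv_mul_cancel, unitary_one]
    rw [mul_assoc, mul_assoc, h, mul_one, ← mul_assoc, h, one_mul]
  have h1 : π (resHom α L x) = inducedRep α π (u * x * star u) i i := by
    change _ = π (resHom α L (star u * (u * x * star u) * u))
    rw [hu]
  rw [h1]
  refine (norm_entry_le_norm_matrixOp (fun i j => inducedRep α π (u * x * star u) i j) i i).trans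
    ((le_universal α ((matrixOpHom _ ℋ).comp (inducedRep α π)) (u * x * star u)).trans ?_)
  change universalNorm α (u * x * star u) ≤ _
  have h2 : universalNorm α u ≤ 1 := universalNorm_unitary_le_one α _
  calc universalNorm α (u * x * star u)
      ≤ universalNorm α u * universalNorm α x * universalNorm α (star u) :=
        ((universalNorm α).mul_le' _ _).trans (mul_le_mul_of_nonneg_right
          ((universalNorm α).mul_le' _ _) ((universalNorm α).nonneg _))
    _ ≤ 1 * universalNorm α x * 1 := by
        rw [CStarSeminorm.star_eq]
        have := (universalNorm α).nonneg x
        have := (universalNorm α).nonneg u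
        gcongr
    _ = universalNorm α x := by rw [one_mul, mul_one]

theorem universalNorm_incl_le (L : Subgroup G) (y : Cc (res α L)) :
    universalNorm α (incl α L y) ≤ universalNorm (res α L) y :=
  universal_le _ fun _ _ _ _ π => le_universal (res α L)
    (π.comp (incl α L).toNonUnitalStarAlgHom) y

theorem universalNorm_incl (L : Subgroup G) [L.FiniteIndex] (y : Cc (res α L)) :
    universalNorm α (incl α L y) = universalNorm (res α L) y := by
  refine le_antisymm (universalNorm_incl_le α L y) ?_
  have := universalNorm_resHom_le α (L := L) (incl α L y)
  rwa [resHom_incl] at this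

theorem universalNorm_restrict_le (L : Subgroup G) [L.FiniteIndex] (x : Cc α) :
    universalNorm α (restrict α L x) ≤ universalNorm α x := by
  rw [← incl_resHom]
  exact (universalNorm_incl_le α L _).trans (universalNorm_resHom_le α x)

end Cc

end UniversalNorms

/-! ### The theorem for both crossed products -/

theorem mainTheorem7 {P : Type u} [CStarAlgebra P] [Nontrivial P]
    {G : Type v} [Group G] [Countable G] (α : G →* (P ≃⋆ₐ[ℂ] P))
    (H K : Subgroup G) (hHK : H < K) (hH : H.FiniteIndex)
    (g : G) (hg : g ∈ Subgroup.normalizer (H : Set G)) :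
    -- the reduced crossed products, for any faithful representation `φ` of `P`
    (∀ (ℋ : Type w) [NormedAddCommGroup ℋ] [InnerProductSpace ℂ ℋ] [CompleteSpace ℋ]
        (φ : P →⋆ₐ[ℂ] (ℋ →L[ℂ] ℋ)), Function.Injective φ →
      (∀ L : Subgroup G, H ≤ L → ∀ y : Cc (Cc.res α L),
        Cc.reducedNorm α φ (Cc.incl α L y) = Cc.reducedNorm (Cc.res α L) φ y) ∧
      (∃ E, IsCanonicalExpectation (Cc.reducedNorm α φ) H E) ∧
      ∀ E, IsCanonicalExpectation (Cc.reducedNorm α φ) H E →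
        HasFiniteIndex E ∧
        crossedSub (Cc.reducedNorm α φ) K ∈
          IMS (crossedSub (Cc.reducedNorm α φ) H) E \ {crossedSub (Cc.reducedNorm α φ) H} ∧
        crossedSub (Cc.reducedNorm α φ) (conjSubgroup g K) ∈
          IMS (crossedSub (Cc.reducedNorm α φ) H) E \ {crossedSub (Cc.reducedNorm α φ) H} ∧
        (interiorAngle E (crossedSub (Cc.reducedNorm α φ) K)
            (crossedSub (Cc.reducedNorm α φ) (conjSubgroup g K)) = 0 ↔
          g ∈ Subgroup.normalizer (K : Set G))) ∧
    -- the universal crossed products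
    ((∀ L : Subgroup G, H ≤ L → ∀ y : Cc (Cc.res α L),
        Cc.universalNorm α (Cc.incl α L y) = Cc.universalNorm (Cc.res α L) y) ∧
      (∃ E, IsCanonicalExpectation (Cc.universalNorm α) H E) ∧
      ∀ E, IsCanonicalExpectation (Cc.universalNorm α) H E →
        HasFiniteIndex E ∧
        crossedSub (Cc.universalNorm α) K ∈
          IMS (crossedSub (Cc.universalNorm α) H) E \ {crossedSub (Cc.universalNorm α) H} ∧
        crossedSub (Cc.universalNorm α) (conjSubgroup g K) ∈
          IMS (crossedSub (Cc.universalNorm α) H) E \ {crossedSub (Cc.universalNorm α) H} ∧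
        (interiorAngle E (crossedSub (Cc.universalNorm α) K)
            (crossedSub (Cc.universalNorm α) (conjSubgroup g K)) = 0 ↔
          g ∈ Subgroup.normalizer (K : Set G))) := by
  have hfin : ∀ L, H ≤ L → L.FiniteIndex := fun L hL => Subgroup.finiteIndex_of_le hL
  refine ⟨fun ℋ _ _ _ φ hφ => ⟨fun L _ => Cc.reducedNorm_incl α φ hφ L, ?_⟩,
    fun L hL => have := hfin L hL; Cc.universalNorm_incl α L, ?_⟩
  · have : Nontrivial ℋ := by
      by_contra h
      rw [not_nontrivial_iff_subsingleton] at h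
      exact one_ne_zero (hφ (Subsingleton.elim (φ 1) (φ 0)))
    refine angle_theorem_of_contractive ?_
      (fun L _ => Cc.reducedNorm_restrict_le α φ hφ L) hHK hg
    rw [Cc.reducedNorm_one]
    exact one_ne_zero
  · exact angle_theorem_of_contractive (Cc.universalNorm_one_ne_zero α)
      (fun L hL => have := hfin L hL; Cc.universalNorm_restrict_le α L) hHK hg
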